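/- On $M=\mathbb R\times\mathbb T^2$, where $\mathbb T^2=\mathbb S^1\times\mathbb S^1$, with coordinates $(r,x,y)$ ($x,y$ being $2\pi$-periodic), there exist a smooth Riemannian metric $g$ and a smooth function $f:M\to\mathbb R$ of the form $$g=dr^2+e^{2h(r)}(dx^2+dy^2),\qquad f=f(r),$$ with $h,f:\mathbb R\to\mathbb R$ smooth, such that $(M,g,f)$ is an expanding gradient Ricci soliton, $$\mathrm{Ric}+\mathrm{Hess}\, f+\tfrac12 g=0,$$ and the following hold. 1. All sectional curvatures satisfy $-\frac14<\sec<0$. 2. At the end $r\to-\infty$ the soliton approaches the hyperbolic cusp expanding soliton (a metric $dr^2+e^{r+2c}(dx^2+dy^2)$ of constant curvature $-\frac14$, with constant potential). Precisely, as $r\to-\infty$: $h\sim\frac r2$; $h-\frac r2$ converges; $h'\to\frac12$; $h''\to0$; $f$ converges to a constant; $f'\to0$; $f''\to0$; and $\sec\to-\frac14$ uniformly over the tori and over all tangent planes. 3. At the end $r\to+\infty$ the soliton approaches locally the flat Gaussian expanding soliton on a cone $dr^2+e^{2c}r^2(dx^2+dy^2)$. Precisely, as $r\to+\infty$: $h\sim\ln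 r$; $h-\ln r$ converges; $h'\sim\frac1r$; $h''\to0$; $f\sim-\frac{r^2}4$; $f'\sim-\frac r2$; $f''\to-\frac12$; and $\sec\to0$ uniformly over the tori and over all tangent planes. 4. The curve $(H,F)=(h',f')$ is a separatrix of the planar system $$H'=HF-2H^2+\tfrac12,\qquad F'=2HF-2H^2+\tfrac12$$ emanating from the saddle point $(\frac12,0)$: it is a nonconstant solution defined for all $r\in\mathbb R$ that tends to $(\frac12,0)$ as $r\to-\infty$. As $r\to+\infty$, $H\to0$ and $F\to-\infty$. Here $\phi\sim\psi$ means $\phi/\psi\to1$. -/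

import Mathlib

open Filter Topology Manifold ContDiff

noncomputable section

namespace Soliton

/-! ### Riemannian geometry in coordinates

`G` is the matrix field `G u i j = g(∂ᵢ, ∂ⱼ)` of a Riemannian metric in coordinates
`u = (u₁, …, uₙ)`. -/

/-- The partial derivative `∂ᵢ F (u)`. -/
def partialDeriv {n : ℕ} (i : Fin n) (F : (Fin n → ℝ) → ℝ) (u : Fin n → ℝ) : ℝ :=
  fderiv ℝ F u (Pi.single i 1)

/-- The Christoffel symbol `Γᵏᵢⱼ = ½ ∑ₗ gᵏˡ (∂ᵢ gⱼₗ + ∂ⱼ gᵢₗ - ∂ₗ gᵢⱼ)` of the Levi-Civita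
connection. -/
def christoffel {n : ℕ} (G : (Fin n → ℝ) → Matrix (Fin n) (Fin n) ℝ) (k i j : Fin n)
    (u : Fin n → ℝ) : ℝ :=
  (1 / 2) * ∑ l, (G u)⁻¹ k l *
    (partialDeriv i (fun w => G w j l) u + partialDeriv j (fun w => G w i l) u
      - partialDeriv l (fun w => G w i j) u)

/-- The component `Rˡₖᵢⱼ` of the curvature tensor, with `R(∂ᵢ, ∂ⱼ)∂ₖ = ∑ₗ Rˡₖᵢⱼ ∂ₗ` and
`R(X, Y)Z = ∇_X ∇_Y Z - ∇_Y ∇_X Z - ∇_[X,Y] Z`. -/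
def riemann {n : ℕ} (G : (Fin n → ℝ) → Matrix (Fin n) (Fin n) ℝ) (l k i j : Fin n)
    (u : Fin n → ℝ) : ℝ :=
  partialDeriv i (christoffel G l j k) u - partialDeriv j (christoffel G l i k) u
    + ∑ m, (christoffel G l i m u * christoffel G m j k u
      - christoffel G l j m u * christoffel G m i k u)

/-- The Ricci tensor `Ric(∂ⱼ, ∂ₖ)`, the trace of `X ↦ R(X, ∂ⱼ)∂ₖ`. -/
def ricci {n : ℕ} (G : (Fin n → ℝ) → Matrix (Fin n) (Fin n) ℝ) (j k : Fin n)
    (u : Fin n → ℝ) : ℝ :=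
  ∑ i, riemann G i k i j u

/-- The Hessian `Hess f (∂ᵢ, ∂ⱼ) = ∂ᵢ ∂ⱼ f - ∑ₖ Γᵏᵢⱼ ∂ₖ f`. -/
def hessian {n : ℕ} (G : (Fin n → ℝ) → Matrix (Fin n) (Fin n) ℝ) (f : (Fin n → ℝ) → ℝ)
    (i j : Fin n) (u : Fin n → ℝ) : ℝ :=
  partialDeriv i (partialDeriv j f) u - ∑ k, christoffel G k i j u * partialDeriv k f u

/-- The inner product `g(a, b)` of two coordinate vectors at `u`. -/
def innerAt {n : ℕ} (G : (Fin n → ℝ) → Matrix (Fin n) (Fin n) ℝ) (u a b : Fin n → ℝ) : ℝ :=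
  ∑ i, ∑ j, G u i j * a i * b j

/-- The sectional curvature
`sec(a, b) = g(R(a, b)b, a) / (g(a, a) g(b, b) - g(a, b)²)` of the plane spanned by `a`, `b`. -/
def sectional {n : ℕ} (G : (Fin n → ℝ) → Matrix (Fin n) (Fin n) ℝ) (u a b : Fin n → ℝ) : ℝ :=
  innerAt G u (fun l => ∑ k, ∑ i, ∑ j, riemann G l k i j u * a i * b j * b k) a /
    (innerAt G u a a * innerAt G u b b - innerAt G u a b ^ 2)

/-! ### Riemannian manifolds

The tensors of a Riemannian manifold at a point are computed in smooth coordinates around that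
point.  All conditions below are tensorial, so it does not matter in which coordinates. -/

section Manifold

variable {E : Type*} [NormedAddCommGroup E] [NormedSpace ℝ E]
  {H : Type*} [TopologicalSpace H] {I : ModelWithCorners ℝ E H}
  {M : Type*} [TopologicalSpace M] [ChartedSpace H M] [IsManifold I ∞ M]

/-- The matrix `g(∂ᵢ, ∂ⱼ)` of the metric `g` in the coordinates given by the parametrization `φ`,
that is, the matrix of the pulled back metric `φ^* g`. -/
def gram {n : ℕ} (g : Bundle.ContMDiffRiemannianMetric I ∞ E (TangentSpace I : M → Type _))
    (φ : (Fin n → ℝ) → M) (u : Fin n → ℝ) : Matrix (Fin n) (Fin n) ℝ :=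
  Matrix.of fun i j =>
    g.inner (φ u) (mfderiv 𝓘(ℝ, Fin n → ℝ) I φ u (Pi.single i 1 : Fin n → ℝ))
      (mfderiv 𝓘(ℝ, Fin n → ℝ) I φ u (Pi.single j 1 : Fin n → ℝ))

variable (I) in
/-- `φ` is a smooth parametrization (the inverse of a coordinate system) of a neighbourhood of `p`,
and `u` are the coordinates of `p`. -/
def IsCoordinatesAt {n : ℕ} (φ : (Fin n → ℝ) → M) (u : Fin n → ℝ) (p : M) : Prop :=
  IsLocalDiffeomorphAt 𝓘(ℝ, Fin n → ℝ) I ∞ φ u ∧ φ u = p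

/-- `(M, g, f)` is a gradient Ricci soliton with constant `ε`: the function `f` is smooth and
`Ric + Hess f + (ε / 2) g = 0`.  It is expanding if `ε = 1`. -/
def IsGradientRicciSoliton
    (g : Bundle.ContMDiffRiemannianMetric I ∞ E (TangentSpace I : M → Type _))
    (f : M → ℝ) (ε : ℝ) : Prop :=
  ContMDiff I 𝓘(ℝ, ℝ) ∞ f ∧
  ∀ p : M, ∃ (n : ℕ) (φ : (Fin n → ℝ) → M) (u : Fin n → ℝ),
    IsCoordinatesAt I φ u p ∧
    ∀ i j, ricci (gram g φ) i j u + hessian (gram g φ) (f ∘ φ) i j u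
      + ε / 2 * gram g φ u i j = 0

/-- The sectional curvatures of all tangent planes at `p` lie in the set `S`. -/
def SectionalCurvatureMem
    (g : Bundle.ContMDiffRiemannianMetric I ∞ E (TangentSpace I : M → Type _))
    (p : M) (S : Set ℝ) : Prop :=
  ∃ (n : ℕ) (φ : (Fin n → ℝ) → M) (u : Fin n → ℝ),
    IsCoordinatesAt I φ u p ∧
    ∀ a b : Fin n → ℝ, LinearIndependent ℝ ![a, b] →
      sectional (gram g φ) u a b ∈ S

end Manifold

/-! ### The manifold `ℝ × T²` -/

/-- The product of the real line and the two-torus. -/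
abbrev LineTorus : Type := ℝ × Circle × Circle

/-- The model with corners of the smooth manifold `ℝ × T²`. -/
abbrev lineTorusModel :=
  (𝓘(ℝ, ℝ)).prod ((𝓡 1).prod (𝓡 1))

/-- The coordinates `(r, x, y)` on `ℝ × T²`, with `x` and `y` periodic: the covering map
`(r, x, y) ↦ (r, e^{ix}, e^{iy})`. -/
def torusCoord (u : Fin 3 → ℝ) : LineTorus := (u 0, Circle.exp (u 1), Circle.exp (u 2))

/-- Smooth Riemannian metrics on `ℝ × T²`. -/
abbrev LineTorusMetric : Type :=
  Bundle.ContMDiffRiemannianMetric lineTorusModel ∞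
    (ℝ × EuclideanSpace ℝ (Fin 1) × EuclideanSpace ℝ (Fin 1))
    (TangentSpace lineTorusModel : LineTorus → Type)

/-- `g = dr² + e^{2h(r)} (dx² + dy²)`. -/
def IsWarpedMetric (g : LineTorusMetric) (h : ℝ → ℝ) : Prop :=
  ∀ u : Fin 3 → ℝ, gram g torusCoord u =
    Matrix.diagonal ![1, Real.exp (2 * h (u 0)), Real.exp (2 * h (u 0))]

/-- The sectional curvatures at `(r, z, w)` converge to `κ` as `r` tends to the given end,
uniformly on the tori and over all tangent planes. -/
def SectionalCurvatureTendsto (g : LineTorusMetric) (l : Filter ℝ) (κ : ℝ) : Prop :=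
  ∀ δ > 0, ∀ᶠ r in l, ∀ z w : Circle,
    SectionalCurvatureMem g ((r, z, w) : LineTorus) (Set.Ioo (κ - δ) (κ + δ))

/-! ### Planar dynamics -/

/-- The vector field of the system `H' = HF - 2H² + 1/2`, `F' = 2HF - 2H² + 1/2`. -/
def solitonField (z : ℝ × ℝ) : ℝ × ℝ :=
  (z.1 * z.2 - 2 * z.1 ^ 2 + 1 / 2, 2 * z.1 * z.2 - 2 * z.1 ^ 2 + 1 / 2)

/-- `z` is a (hyperbolic) saddle point of the planar vector field `V`. -/
def IsSaddlePoint (V : ℝ × ℝ → ℝ × ℝ) (z : ℝ × ℝ) : Prop :=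
  V z = 0 ∧ DifferentiableAt ℝ V z ∧ ∃ μ ν : ℝ, μ < 0 ∧ 0 < ν ∧
    Module.End.HasEigenvalue (fderiv ℝ V z : ℝ × ℝ →ₗ[ℝ] ℝ × ℝ) μ ∧
    Module.End.HasEigenvalue (fderiv ℝ V z : ℝ × ℝ →ₗ[ℝ] ℝ × ℝ) ν

/-- `γ` is a separatrix of the planar vector field `V` emanating from the saddle point `z`:
a nonconstant trajectory, defined for all times, that tends to `z` at time `-∞`. -/
def IsSeparatrixFrom (V : ℝ × ℝ → ℝ × ℝ) (z : ℝ × ℝ) (γ : ℝ → ℝ × ℝ) : Prop :=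
  IsSaddlePoint V z ∧ (∀ r, HasDerivAt γ (V (γ r)) r) ∧ (∃ r, γ r ≠ z) ∧
    Tendsto γ atBot (𝓝 z)

end Soliton

end

/-!
A metric `dr² + e^{2h} (dx² + dy²)` has sectional curvatures `-(h'' + h'²)` on the planes containing
`∂_r` and `-h'²` on the planes tangent to the tori, and the soliton equation with radial potential
`f` says that `(H, F) = (h', f')` solves the planar system. The linearization at `(1/2, 0)` has a
single positive eigenvalue `μ`, with `μ² + μ = 1`, and the unstable trajectory is a convergent power
series in `e^{μr}`: since `nμ` is never an eigenvalue for `n ≥ 2`, its coefficients are determined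
recursively.

The region `0 < H < 1/2`, `H' < 0`, `H' + H² > 0` is exactly where `H` decreases and the curvatures
lie in `(-1/4, 0)`. It is forward invariant, because `H`, `-H'` and `H' + H²` solve scalar linear
equations with nonnegative forcing as long as `F ≤ 0`, which `H' < 0 < H < 1/2` implies. The region
contains the branch of the unstable trajectory on which `H < 1/2`, and it bounds `F` on finite time
intervals, so that this trajectory is complete.

The asymptotics follow from the inequalities of the region alone, by monotone comparison. Near `-∞`
one has `F' ≤ H(0) F`, so `F`, and hence any negative function bounded below by `F`, is integrable.
Near `+∞` the derivative of `F` is bounded above by a negative constant, so `1/F²` is integrable,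
and both `F' + 1/2` and `(log (-F) - h)' = H'/F` lie between `0` and `1/F²`.
-/

noncomputable section

namespace Soliton

/-! ### Metrics induced by immersions -/

section InducedMetric

variable {E : Type*} [NormedAddCommGroup E] [NormedSpace ℝ E]
  {H : Type*} [TopologicalSpace H] {I : ModelWithCorners ℝ E H}
  {M : Type*} [TopologicalSpace M] [ChartedSpace H M]
  {V : Type*} [NormedAddCommGroup V] [NormedSpace ℝ V]

theorem isVonNBounded_of_pos [FiniteDimensional ℝ E] (Q : E →L[ℝ] E →L[ℝ] ℝ)
    (hQ : ∀ v, v ≠ 0 → 0 < Q v v) : Bornology.IsVonNBounded ℝ {v : E | Q v v < 1} := by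
  rcases subsingleton_or_nontrivial E with hE | hE
  · exact (NormedSpace.isVonNBounded_iff ℝ).2 (Set.toFinite _).isBounded
  obtain ⟨v₀, hv₀, hmin⟩ := (isCompact_sphere (0 : E) 1).exists_isMinOn
    (NormedSpace.sphere_nonempty.2 zero_le_one)
    (f := fun v => Q v v) (by fun_prop)
  have hm : 0 < Q v₀ v₀ := hQ v₀ (Metric.ne_of_mem_sphere hv₀ one_ne_zero)
  have coercive : ∀ v, Q v₀ v₀ * ‖v‖ ^ 2 ≤ Q v v := by
    intro v
    rcases eq_or_ne v 0 with rfl | hv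
    · simp
    have hn : 0 < ‖v‖ := norm_pos_iff.2 hv
    have h : Q v₀ v₀ ≤ Q (‖v‖⁻¹ • v) (‖v‖⁻¹ • v) := hmin (by simp [norm_smul, hn.ne'])
    simp only [map_smul, smul_apply, smul_eq_mul] at h
    calc Q v₀ v₀ * ‖v‖ ^ 2 ≤ (‖v‖⁻¹ * (‖v‖⁻¹ * Q v v)) * ‖v‖ ^ 2 := by gcongr
      _ = Q v v := by field_simp
  rw [NormedSpace.isVonNBounded_iff, isBounded_iff_forall_norm_le]
  refine ⟨√(1 / Q v₀ v₀), fun v hv => Real.le_sqrt_of_sq_le ?_⟩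
  rw [le_div_iff₀ hm, mul_comm]
  exact (coercive v).trans (le_of_lt hv)

variable (I) in
/-- The pullback `J^* B` of a family of bilinear forms on `V` by a map `J : M → V`. -/
def pullbackForm (J : M → V) (B : M → V →L[ℝ] V →L[ℝ] ℝ) (p : M) :
    TangentSpace I p →L[ℝ] TangentSpace I p →L[ℝ] ℝ :=
  (B p).bilinearComp (E' := E) (F' := E) (mvfderiv I J p) (mvfderiv I J p)

theorem contMDiffAt_bilinearComp {W : Type*} [NormedAddCommGroup W] [NormedSpace ℝ W] {x₀ : M}
    {B : M → V →L[ℝ] V →L[ℝ] ℝ} (hB : ContMDiffAt I 𝓘(ℝ, V →L[ℝ] V →L[ℝ] ℝ) ∞ B x₀)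
    {A : M → W →L[ℝ] V} (hA : ContMDiffAt I 𝓘(ℝ, W →L[ℝ] V) ∞ A x₀) :
    ContMDiffAt I 𝓘(ℝ, W →L[ℝ] W →L[ℝ] ℝ) ∞ (fun x => (B x).bilinearComp (A x) (A x)) x₀ :=
  ((hA.clm_precomp (F₃ := ℝ)).clm_comp hB).clm_comp hA

variable [IsManifold I ∞ M]

theorem contMDiff_pullbackForm {J : M → V} (hJ : ContMDiff I 𝓘(ℝ, V) ∞ J)
    {B : M → V →L[ℝ] V →L[ℝ] ℝ} (hB : ContMDiff I 𝓘(ℝ, V →L[ℝ] V →L[ℝ] ℝ) ∞ B) :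
    ContMDiff I (I.prod 𝓘(ℝ, E →L[ℝ] E →L[ℝ] ℝ)) ∞
      (fun p => Bundle.TotalSpace.mk' (E →L[ℝ] E →L[ℝ] ℝ)
          (E := (fun p : M => TangentSpace I p →L[ℝ] TangentSpace I p →L[ℝ] ℝ)) p
          (pullbackForm I J B p)) := by
  intro x₀
  rw [contMDiffAt_hom_bundle]
  refine ⟨contMDiffAt_id, ?_⟩
  set A : M → E →L[ℝ] V := inTangentCoordinates I 𝓘(ℝ, V) id J (mfderiv I 𝓘(ℝ, V) J) x₀
  have hA : ContMDiffAt I 𝓘(ℝ, E →L[ℝ] V) ∞ A x₀ := (hJ x₀).mfderiv_const le_rfl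
  refine (contMDiffAt_bilinearComp (hB x₀) hA).congr_of_eventuallyEq ?_
  filter_upwards [(trivializationAt E (TangentSpace I) x₀).open_baseSet.mem_nhds
    (FiberBundle.mem_baseSet_trivializationAt E (TangentSpace I) x₀)] with x hx
  have hAx : ∀ v : E, A x v =
      mvfderiv I J x ((trivializationAt E (TangentSpace I) x₀).symm x v) := by
    intro v
    rw [← Bundle.Trivialization.symmL_apply (R := ℝ) _ hx]
    simp only [A, inTangentCoordinates, ContinuousLinearMap.inCoordinates,
      TangentBundle.continuousLinearMapAt_model_space, id_eq, mvfderiv,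
      ContinuousLinearMap.comp_apply, ContinuousLinearEquiv.coe_coe]
    rfl
  ext v w
  refine (inCoordinates_apply_eq₂ hx hx (by simp)).trans ?_
  rw [ContinuousLinearMap.bilinearComp_apply, hAx, hAx]
  simp only [Bundle.Trivial.fiberBundle_trivializationAt',
    Bundle.Trivial.linearMapAt_trivialization, LinearMap.id_coe, id_eq]
  rfl

/-- The Riemannian metric `p ↦ J^* (B p)` that an immersion `J` of `M` in a vector space `V` and
a family of inner products `B p` on `V` induce on `M`. -/
def inducedMetric [FiniteDimensional ℝ E] (J : M → V) (hJ : ContMDiff I 𝓘(ℝ, V) ∞ J)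
    (hJinj : ∀ p, Function.Injective (mvfderiv I J p))
    (B : M → V →L[ℝ] V →L[ℝ] ℝ) (hB : ContMDiff I 𝓘(ℝ, V →L[ℝ] V →L[ℝ] ℝ) ∞ B)
    (hBsymm : ∀ p v w, B p v w = B p w v) (hBpos : ∀ p v, v ≠ 0 → 0 < B p v v) :
    Bundle.ContMDiffRiemannianMetric I ∞ E (TangentSpace I : M → Type _) where
  inner := pullbackForm I J B
  symm p _ _ := hBsymm p _ _
  pos p _ hv := hBpos p _ ((map_ne_zero_iff _ (hJinj p)).2 hv)
  isVonNBounded p := isVonNBounded_of_pos (E := E) _ fun _ hv =>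
    hBpos p _ ((map_ne_zero_iff _ (hJinj p)).2 hv)
  contMDiff := contMDiff_pullbackForm hJ hB

theorem gram_inducedMetric [FiniteDimensional ℝ E] {J : M → V} (hJ : ContMDiff I 𝓘(ℝ, V) ∞ J)
    (hJinj : ∀ p, Function.Injective (mvfderiv I J p))
    {B : M → V →L[ℝ] V →L[ℝ] ℝ} (hB : ContMDiff I 𝓘(ℝ, V →L[ℝ] V →L[ℝ] ℝ) ∞ B)
    (hBsymm : ∀ p v w, B p v w = B p w v) (hBpos : ∀ p v, v ≠ 0 → 0 < B p v v)
    {n : ℕ} {φ : (Fin n → ℝ) → M} {u : Fin n → ℝ} (hφ : MDifferentiableAt 𝓘(ℝ, Fin n → ℝ) I φ u)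
    {L : (Fin n → ℝ) →L[ℝ] V} (hL : HasFDerivAt (J ∘ φ) L u) (i j : Fin n) :
    gram (inducedMetric J hJ hJinj B hB hBsymm hBpos) φ u i j =
      B (φ u) (L (Pi.single i 1)) (L (Pi.single j 1)) := by
  have hJφ : ∀ v : Fin n → ℝ,
      mvfderiv I J (φ u) (mfderiv 𝓘(ℝ, Fin n → ℝ) I φ u v) = L v := fun v => by
    have hJφu := mfderiv_comp u ((hJ (φ u)).mdifferentiableAt (by simp)) hφ
    rw [mfderiv_eq_fderiv, hL.fderiv] at hJφu
    exact (DFunLike.congr_fun hJφu v).symm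
  exact congrArg₂ (fun v w => B (φ u) v w) (hJφ _) (hJφ _)

end InducedMetric

/-! ### The warped metric on `ℝ × 𝕋²` -/

section LineTorus

/-- The standard embedding of `ℝ × T²` in `ℝ × ℂ × ℂ`. -/
def lineTorusEmbedding (p : LineTorus) : ℝ × ℂ × ℂ := (p.1, (p.2.1 : ℂ), (p.2.2 : ℂ))

theorem contMDiff_circleCoe : ContMDiff (𝓡 1) 𝓘(ℝ, ℂ) ∞ (fun z : Circle => (z : ℂ)) :=
  haveI := finrank_real_complex_fact'
  contMDiff_coe_sphere

theorem injective_mvfderiv_circleCoe (z : Circle) :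
    Function.Injective (mvfderiv (𝓡 1) (fun z : Circle => (z : ℂ)) z) :=
  haveI := finrank_real_complex_fact'
  injective_mvfderiv_subtypeVal_sphere z

theorem contMDiff_lineTorusEmbedding :
    ContMDiff lineTorusModel 𝓘(ℝ, ℝ × ℂ × ℂ) ∞ lineTorusEmbedding :=
  contMDiff_fst.prodMk_space
    ((contMDiff_circleCoe.comp (contMDiff_fst.comp contMDiff_snd)).prodMk_space
      (contMDiff_circleCoe.comp (contMDiff_snd.comp contMDiff_snd)))

theorem mvfderiv_lineTorusEmbedding (p : LineTorus)
    (v : ℝ × EuclideanSpace ℝ (Fin 1) × EuclideanSpace ℝ (Fin 1)) :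
    mvfderiv lineTorusModel lineTorusEmbedding p v =
      (v.1, mvfderiv (𝓡 1) (fun z : Circle => (z : ℂ)) p.2.1 v.2.1,
        mvfderiv (𝓡 1) (fun z : Circle => (z : ℂ)) p.2.2 v.2.2) := by
  have hcoe (z : Circle) := ((contMDiff_circleCoe z).mdifferentiableAt (by simp)).hasMFDerivAt
  have hsnd := hasMFDerivAt_snd (I := 𝓘(ℝ, ℝ)) (I' := (𝓡 1).prod (𝓡 1)) (x := p)
  have h₀ := hasMFDerivAt_fst (I := 𝓘(ℝ, ℝ)) (I' := (𝓡 1).prod (𝓡 1)) (x := p)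
  have h₁ := (hcoe p.2.1).comp p
    ((hasMFDerivAt_fst (I := 𝓡 1) (I' := 𝓡 1) (x := p.2)).comp p hsnd)
  have h₂ := (hcoe p.2.2).comp p
    ((hasMFDerivAt_snd (I := 𝓡 1) (I' := 𝓡 1) (x := p.2)).comp p hsnd)
  have h : HasMFDerivAt lineTorusModel 𝓘(ℝ, ℝ × ℂ × ℂ) lineTorusEmbedding p _ :=
    ⟨h₀.1.prodMk (h₁.1.prodMk h₂.1), h₀.2.prodMk (h₁.2.prodMk h₂.2)⟩
  rw [mvfderiv, h.mfderiv]
  rfl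

theorem injective_mvfderiv_lineTorusEmbedding (p : LineTorus) :
    Function.Injective (mvfderiv lineTorusModel lineTorusEmbedding p) := by
  intro v w hvw
  have h := (mvfderiv_lineTorusEmbedding p v).symm.trans
    (hvw.trans (mvfderiv_lineTorusEmbedding p w))
  rw [Prod.mk.injEq, Prod.mk.injEq] at h
  exact Prod.ext h.1 (Prod.ext (injective_mvfderiv_circleCoe _ h.2.1)
    (injective_mvfderiv_circleCoe _ h.2.2))

/-- The bilinear form `dr² + s (|dz|² + |dw|²)` on `ℝ × ℂ × ℂ`. -/
def warpedForm (s : ℝ) : (ℝ × ℂ × ℂ) →L[ℝ] (ℝ × ℂ × ℂ) →L[ℝ] ℝ :=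
  let dr := ContinuousLinearMap.fst ℝ ℝ (ℂ × ℂ)
  let dz := ContinuousLinearMap.fst ℝ ℂ ℂ ∘L ContinuousLinearMap.snd ℝ ℝ (ℂ × ℂ)
  let dw := ContinuousLinearMap.snd ℝ ℂ ℂ ∘L ContinuousLinearMap.snd ℝ ℝ (ℂ × ℂ)
  (innerSL ℝ).bilinearComp dr dr +
    s • ((innerSL ℝ).bilinearComp dz dz + (innerSL ℝ).bilinearComp dw dw)

theorem warpedForm_apply (s : ℝ) (v w : ℝ × ℂ × ℂ) :
    warpedForm s v w =
      v.1 * w.1 + s * (inner ℝ v.2.1 w.2.1 + inner ℝ v.2.2 w.2.2) := by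
  rw [← Real.inner_apply]
  rfl

theorem warpedForm_comm (s : ℝ) (v w : ℝ × ℂ × ℂ) : warpedForm s v w = warpedForm s w v := by
  simp only [warpedForm_apply, real_inner_comm, mul_comm]

theorem warpedForm_self_pos {s : ℝ} (hs : 0 < s) {v : ℝ × ℂ × ℂ} (hv : v ≠ 0) :
    0 < warpedForm s v v := by
  obtain ⟨a, z, w⟩ := v
  simp only [warpedForm_apply, real_inner_self_eq_norm_sq, ← sq]
  have : a ≠ 0 ∨ z ≠ 0 ∨ w ≠ 0 := by simpa only [ne_eq, Prod.mk_eq_zero, not_and_or] using hv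
  rcases this with h | h | h <;> positivity

theorem contMDiff_warpedForm {h : ℝ → ℝ} (hh : ContDiff ℝ ∞ h) :
    ContMDiff lineTorusModel 𝓘(ℝ, (ℝ × ℂ × ℂ) →L[ℝ] (ℝ × ℂ × ℂ) →L[ℝ] ℝ) ∞
      fun p : LineTorus => warpedForm (Real.exp (2 * h p.1)) := by
  have : ContDiff ℝ ∞ fun r => warpedForm (Real.exp (2 * h r)) :=
    contDiff_clm_apply_iff.2 fun v => contDiff_clm_apply_iff.2 fun w => by
      simp only [warpedForm_apply]
      exact contDiff_const.add
        ((Real.contDiff_exp.comp (contDiff_const.mul hh)).mul contDiff_const)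
  exact this.contMDiff.comp contMDiff_fst

/-- The warped product metric `dr² + e^{2h(r)} (dx² + dy²)`, as the metric that
`dr² + e^{2h(r)} (|dz|² + |dw|²)` induces on `ℝ × T² ⊆ ℝ × ℂ × ℂ`. -/
def warpedMetric (h : ℝ → ℝ) (hh : ContDiff ℝ ∞ h) : LineTorusMetric :=
  inducedMetric lineTorusEmbedding contMDiff_lineTorusEmbedding
    injective_mvfderiv_lineTorusEmbedding (fun p => warpedForm (Real.exp (2 * h p.1)))
    (contMDiff_warpedForm hh) (fun _ => warpedForm_comm _)
    (fun _ _ => warpedForm_self_pos (Real.exp_pos _))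

theorem contMDiff_torusCoord :
    ContMDiff 𝓘(ℝ, Fin 3 → ℝ) lineTorusModel ∞ torusCoord := by
  have hproj (i : Fin 3) : ContMDiff 𝓘(ℝ, Fin 3 → ℝ) 𝓘(ℝ, ℝ) ∞ (fun u : Fin 3 → ℝ => u i) :=
    (contDiff_apply ℝ ℝ i).contMDiff
  exact (hproj 0).prodMk ((contMDiff_circleExp.comp (hproj 1)).prodMk
    (contMDiff_circleExp.comp (hproj 2)))

theorem hasDerivAt_circleExp (t : ℝ) :
    HasDerivAt (fun t : ℝ => (Circle.exp t : ℂ)) (Circle.exp t * Complex.I) t := by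
  have : HasDerivAt (fun t : ℝ => (t : ℂ) * Complex.I) Complex.I t := by
    simpa using (Complex.ofRealCLM.hasDerivAt (x := t)).mul_const Complex.I
  simpa only [Circle.coe_exp] using this.cexp

theorem hasFDerivAt_lineTorusEmbedding_comp_torusCoord (u : Fin 3 → ℝ) :
    HasFDerivAt (lineTorusEmbedding ∘ torusCoord)
      ((ContinuousLinearMap.proj (R := ℝ) 0).prod
        (((ContinuousLinearMap.proj 1).smulRight (Circle.exp (u 1) * Complex.I : ℂ)).prod
          ((ContinuousLinearMap.proj 2).smulRight (Circle.exp (u 2) * Complex.I : ℂ)))) u := by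
  have hproj (i : Fin 3) : HasFDerivAt (fun u : Fin 3 → ℝ => u i) (.proj (R := ℝ) i) u :=
    hasFDerivAt_apply i u
  have hcircle (i : Fin 3) : HasFDerivAt (fun v : Fin 3 → ℝ => (Circle.exp (v i) : ℂ))
      ((ContinuousLinearMap.proj (R := ℝ) i).smulRight (Circle.exp (u i) * Complex.I : ℂ)) u :=
    (HasFDerivAt.comp (g := fun t : ℝ => (Circle.exp t : ℂ)) u
      (hasDerivAt_circleExp (u i)).hasFDerivAt (hproj i)).congr_fderiv (by ext; rfl)
  exact (hproj 0).prodMk ((hcircle 1).prodMk (hcircle 2))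

theorem isWarpedMetric_warpedMetric (h : ℝ → ℝ) (hh : ContDiff ℝ ∞ h) :
    IsWarpedMetric (warpedMetric h hh) h := by
  intro u
  have hinner (t a b : ℝ) : inner ℝ (a • (Circle.exp t * Complex.I : ℂ))
      (b • (Circle.exp t * Complex.I : ℂ)) = a * b := by
    rw [real_inner_smul_left, real_inner_smul_right, real_inner_self_eq_norm_sq]
    simp
  ext i j
  rw [warpedMetric, gram_inducedMetric _ _ _ _ _
    ((contMDiff_torusCoord u).mdifferentiableAt (by simp))
    (hasFDerivAt_lineTorusEmbedding_comp_torusCoord u), warpedForm_apply]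
  simp only [ContinuousLinearMap.prod_apply, ContinuousLinearMap.smulRight_apply,
    ContinuousLinearMap.proj_apply, hinner]
  fin_cases i <;> fin_cases j <;> simp [torusCoord, Matrix.diagonal]

/-- The inverse of `Circle.exp` that takes values in the interval of length `2π` centred at
`t`; it is smooth off the antipode of `e^{it}`. -/
def circleLift (t : ℝ) (z : Circle) : ℝ := t + Complex.arg ((z * Circle.exp (-t) : Circle) : ℂ)

theorem exp_circleLift (t : ℝ) (z : Circle) : Circle.exp (circleLift t z) = z := by
  rw [circleLift, Circle.exp_add, Circle.exp_arg, mul_left_comm, ← Circle.exp_add]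
  simp

theorem circleLift_exp {t s : ℝ} (hs : s ∈ Set.Ioo (t - Real.pi) (t + Real.pi)) :
    circleLift t (Circle.exp s) = s := by
  rw [circleLift, ← Circle.exp_add, Circle.arg_exp] <;> linarith [hs.1, hs.2]

/-- The arc of the circle centred at `e^{it}` that omits the antipode. -/
def circleArc (t : ℝ) : Set Circle :=
  {z | ((z * Circle.exp (-t) : Circle) : ℂ) ∈ Complex.slitPlane}

theorem isOpen_circleArc (t : ℝ) : IsOpen (circleArc t) :=
  Complex.isOpen_slitPlane.preimage (by fun_prop)

theorem mem_circleArc_iff {t : ℝ} {z : Circle} :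
    z ∈ circleArc t ↔ circleLift t z ∈ Set.Ioo (t - Real.pi) (t + Real.pi) := by
  have hle := Complex.arg_le_pi ((z * Circle.exp (-t) : Circle) : ℂ)
  have hlt := Complex.neg_pi_lt_arg ((z * Circle.exp (-t) : Circle) : ℂ)
  rw [circleArc, Set.mem_ofPred_eq, Complex.mem_slitPlane_iff_arg, circleLift, Set.mem_Ioo,
    and_iff_left (Circle.coe_ne_zero _)]
  constructor
  · intro hne
    have := lt_of_le_of_ne hle hne
    constructor <;> linarith
  · rintro ⟨-, h⟩ heq
    linarith

theorem contMDiffOn_circleLift (t : ℝ) :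
    ContMDiffOn (𝓡 1) 𝓘(ℝ, ℝ) ∞ (circleLift t) (circleArc t) := by
  intro z hz
  have hlog : ContDiffAt ℝ ∞ Complex.log ((z * Circle.exp (-t) : Circle) : ℂ) :=
    (Complex.contDiffAt_log hz).restrict_scalars ℝ
  have harg : ContDiffAt ℝ ∞ (fun w : ℂ => t + Complex.arg w)
      ((z * Circle.exp (-t) : Circle) : ℂ) :=
    contDiffAt_const.add (by
      simpa only [Function.comp_def, Complex.imCLM_apply, Complex.log_im] using
        Complex.imCLM.contDiff.contDiffAt.comp _ hlog)
  have hmul : ContMDiff (𝓡 1) 𝓘(ℝ, ℂ) ∞ fun w : Circle => ((w * Circle.exp (-t) : Circle) : ℂ) :=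
    contMDiff_circleCoe.comp (contMDiff_mul_right (I := 𝓡 1) (n := ∞))
  exact (harg.contMDiffAt.comp z (hmul z)).contMDiffWithinAt

/-- The coordinates `torusCoord` near `u`, as a partial diffeomorphism. -/
def torusPartialDiffeomorph (u : Fin 3 → ℝ) :
    PartialDiffeomorph 𝓘(ℝ, Fin 3 → ℝ) lineTorusModel (Fin 3 → ℝ) LineTorus ∞ where
  toFun := torusCoord
  invFun p := ![p.1, circleLift (u 1) p.2.1, circleLift (u 2) p.2.2]
  source := {v | v 1 ∈ Set.Ioo (u 1 - Real.pi) (u 1 + Real.pi) ∧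
    v 2 ∈ Set.Ioo (u 2 - Real.pi) (u 2 + Real.pi)}
  target := {p | p.2.1 ∈ circleArc (u 1) ∧ p.2.2 ∈ circleArc (u 2)}
  map_source' v hv := by
    simp only [Set.mem_ofPred_eq, mem_circleArc_iff, torusCoord, circleLift_exp hv.1,
      circleLift_exp hv.2]
    exact hv
  map_target' p hp := ⟨mem_circleArc_iff.1 hp.1, mem_circleArc_iff.1 hp.2⟩
  left_inv' v hv := by
    ext i
    fin_cases i
    exacts [rfl, circleLift_exp hv.1, circleLift_exp hv.2]
  right_inv' p _ := Prod.ext rfl (Prod.ext (exp_circleLift _ _) (exp_circleLift _ _))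
  open_source := (isOpen_Ioo.preimage (continuous_apply 1)).inter
    (isOpen_Ioo.preimage (continuous_apply 2))
  open_target := ((isOpen_circleArc _).preimage (by fun_prop)).inter
    ((isOpen_circleArc _).preimage (by fun_prop))
  contMDiffOn_toFun := contMDiff_torusCoord.contMDiffOn
  contMDiffOn_invFun := by
    rw [contMDiffOn_pi_space]
    intro i
    fin_cases i
    · exact contMDiff_fst.contMDiffOn
    · exact (contMDiffOn_circleLift (u 1)).comp
        (contMDiff_fst.comp contMDiff_snd).contMDiffOn fun p hp => hp.1
    · exact (contMDiffOn_circleLift (u 2)).comp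
        (contMDiff_snd.comp contMDiff_snd).contMDiffOn fun p hp => hp.2

theorem isCoordinatesAt_torusCoord (u : Fin 3 → ℝ) :
    IsCoordinatesAt lineTorusModel torusCoord u (torusCoord u) :=
  ⟨(torusPartialDiffeomorph u).isLocalDiffeomorphAt _ _ _
    ⟨by constructor <;> linarith [Real.pi_pos], by constructor <;> linarith [Real.pi_pos]⟩, rfl⟩

theorem surjective_torusCoord : Function.Surjective torusCoord := fun p =>
  ⟨![p.1, Complex.arg p.2.1, Complex.arg p.2.2],
    Prod.ext rfl (Prod.ext (Circle.exp_arg _) (Circle.exp_arg _))⟩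

end LineTorus

/-! ### Curvature of the warped metric -/

section Curvature

theorem partialDeriv_const {n : ℕ} (i : Fin n) (c : ℝ) (u : Fin n → ℝ) :
    partialDeriv i (fun _ => c) u = 0 := by
  simp [partialDeriv]

theorem partialDeriv_comp_apply {n : ℕ} (i j : Fin n) {ψ : ℝ → ℝ} {ψ' : ℝ} {u : Fin n → ℝ}
    (hψ : HasDerivAt ψ ψ' (u j)) :
    partialDeriv i (fun w => ψ (w j)) u = if i = j then ψ' else 0 := by
  have h : HasFDerivAt (fun w : Fin n → ℝ => ψ (w j))
      (ψ' • ContinuousLinearMap.proj (R := ℝ) (φ := fun _ : Fin n => ℝ) j) u :=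
    hψ.comp_hasFDerivAt u (hasFDerivAt_apply j u)
  rw [partialDeriv, h.fderiv]
  simp [Pi.single_apply, eq_comm]

/-- The metric `dr² + e^{2h(r)} (dx² + dy²)` in the coordinates `(r, x, y)`. -/
def warpedGram (h : ℝ → ℝ) (u : Fin 3 → ℝ) : Matrix (Fin 3) (Fin 3) ℝ :=
  Matrix.diagonal ![1, Real.exp (2 * h (u 0)), Real.exp (2 * h (u 0))]

theorem warpedGram_inv (h : ℝ → ℝ) (u : Fin 3 → ℝ) :
    (warpedGram h u)⁻¹ =
      Matrix.diagonal ![1, (Real.exp (2 * h (u 0)))⁻¹, (Real.exp (2 * h (u 0)))⁻¹] := by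
  apply Matrix.inv_eq_right_inv
  rw [warpedGram, Matrix.diagonal_mul_diagonal, ← Matrix.diagonal_one]
  congr 1
  ext i
  fin_cases i <;> simp

theorem innerAt_warpedGram (h : ℝ → ℝ) (u a b : Fin 3 → ℝ) :
    innerAt (warpedGram h) u a b =
      a 0 * b 0 + Real.exp (2 * h (u 0)) * (a 1 * b 1 + a 2 * b 2) := by
  simp [innerAt, warpedGram, Fin.sum_univ_three, Matrix.diagonal]
  ring

/-- The Christoffel symbols of `dr² + e^{2h(r)} (dx² + dy²)`. -/
def warpedChristoffel (h : ℝ → ℝ) (r : ℝ) : Fin 3 → Fin 3 → Fin 3 → ℝ :=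
  ![![![0, 0, 0], ![0, -(deriv h r * Real.exp (2 * h r)), 0],
      ![0, 0, -(deriv h r * Real.exp (2 * h r))]],
    ![![0, deriv h r, 0], ![deriv h r, 0, 0], ![0, 0, 0]],
    ![![0, 0, deriv h r], ![0, 0, 0], ![deriv h r, 0, 0]]]

/-- The radial derivatives of the Christoffel symbols of `dr² + e^{2h(r)} (dx² + dy²)`. -/
def warpedChristoffelDeriv (h : ℝ → ℝ) (r : ℝ) : Fin 3 → Fin 3 → Fin 3 → ℝ :=
  ![![![0, 0, 0], ![0, -((deriv (deriv h) r + 2 * deriv h r ^ 2) * Real.exp (2 * h r)), 0],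
      ![0, 0, -((deriv (deriv h) r + 2 * deriv h r ^ 2) * Real.exp (2 * h r))]],
    ![![0, deriv (deriv h) r, 0], ![deriv (deriv h) r, 0, 0], ![0, 0, 0]],
    ![![0, 0, deriv (deriv h) r], ![0, 0, 0], ![deriv (deriv h) r, 0, 0]]]

/-- The sectional curvature of the coordinate plane of `∂ᵢ` and `∂ⱼ` for the metric
`dr² + e^{2h(r)} (dx² + dy²)`; the value for `i = j` is irrelevant. -/
def warpedCurvature (h : ℝ → ℝ) (r : ℝ) (i j : Fin 3) : ℝ :=
  if i = 0 ∨ j = 0 then -(deriv (deriv h) r + deriv h r ^ 2) else -deriv h r ^ 2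

variable {h : ℝ → ℝ} (hh : ContDiff ℝ 2 h)
include hh

theorem hasDerivAt_exp_two_mul (r : ℝ) :
    HasDerivAt (fun r => Real.exp (2 * h r)) (2 * deriv h r * Real.exp (2 * h r)) r :=
  (((hh.differentiable (by simp) r).hasDerivAt.const_mul 2).exp).congr_deriv (by ring)

theorem partialDeriv_warpedGram (i j l : Fin 3) (u : Fin 3 → ℝ) :
    partialDeriv i (fun w => warpedGram h w j l) u =
      if i = 0 ∧ j = l ∧ j ≠ 0 then 2 * deriv h (u 0) * Real.exp (2 * h (u 0)) else 0 := by
  by_cases hjl : j = l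
  · subst hjl
    by_cases hj : j = 0
    · subst hj
      simp [warpedGram, partialDeriv_const]
    · have : (fun w => warpedGram h w j j) = fun w => Real.exp (2 * h (w 0)) := by
        ext w
        fin_cases j <;> simp [warpedGram] at hj ⊢
      rw [this, partialDeriv_comp_apply i 0 (hasDerivAt_exp_two_mul hh (u 0))]
      simp [hj]
  · simp [warpedGram, hjl, partialDeriv_const]

theorem christoffel_warpedGram (k i j : Fin 3) :
    christoffel (warpedGram h) k i j = fun u => warpedChristoffel h (u 0) k i j := by
  ext u
  have := Real.exp_ne_zero (2 * h (u 0))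
  simp only [christoffel, partialDeriv_warpedGram hh, warpedGram_inv, Fin.sum_univ_three]
  fin_cases k <;> fin_cases i <;> fin_cases j <;>
    simp [warpedChristoffel] <;> field_simp

theorem hasDerivAt_warpedChristoffel (k i j : Fin 3) (r : ℝ) :
    HasDerivAt (fun r => warpedChristoffel h r k i j) (warpedChristoffelDeriv h r k i j) r := by
  have hzero := hasDerivAt_const r (0 : ℝ)
  have hderiv := (hh.differentiable_deriv_two r).hasDerivAt
  have hprod : HasDerivAt (fun r => -(deriv h r * Real.exp (2 * h r)))
      (-((deriv (deriv h) r + 2 * deriv h r ^ 2) * Real.exp (2 * h r))) r :=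
    ((hderiv.mul (hasDerivAt_exp_two_mul hh r)).neg).congr_deriv (by ring)
  fin_cases k <;> fin_cases i <;> fin_cases j <;> first | exact hzero | exact hderiv | exact hprod

theorem riemann_warpedGram (l k i j : Fin 3) (u : Fin 3 → ℝ) :
    riemann (warpedGram h) l k i j u = warpedCurvature h (u 0) i j *
      ((if l = i then warpedGram h u j k else 0) - (if l = j then warpedGram h u i k else 0)) := by
  simp only [riemann, christoffel_warpedGram hh,
    partialDeriv_comp_apply _ 0 (hasDerivAt_warpedChristoffel hh _ _ _ (u 0)), Fin.sum_univ_three]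
  fin_cases l <;> fin_cases k <;> fin_cases i <;> fin_cases j <;>
    simp [warpedChristoffel, warpedChristoffelDeriv, warpedCurvature, warpedGram] <;> ring

theorem ricci_warpedGram (j k : Fin 3) (u : Fin 3 → ℝ) :
    ricci (warpedGram h) j k u =
      Matrix.diagonal ![-2 * (deriv (deriv h) (u 0) + deriv h (u 0) ^ 2),
        -(deriv (deriv h) (u 0) + 2 * deriv h (u 0) ^ 2) * Real.exp (2 * h (u 0)),
        -(deriv (deriv h) (u 0) + 2 * deriv h (u 0) ^ 2) * Real.exp (2 * h (u 0))] j k := by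
  simp only [ricci, riemann_warpedGram hh, Fin.sum_univ_three]
  fin_cases j <;> fin_cases k <;> simp [warpedCurvature, warpedGram] <;> ring

theorem hessian_warpedGram {φ : ℝ → ℝ} (hφ : ContDiff ℝ 2 φ) (i j : Fin 3) (u : Fin 3 → ℝ) :
    hessian (warpedGram h) (fun w => φ (w 0)) i j u =
      Matrix.diagonal ![deriv (deriv φ) (u 0),
        deriv h (u 0) * deriv φ (u 0) * Real.exp (2 * h (u 0)),
        deriv h (u 0) * deriv φ (u 0) * Real.exp (2 * h (u 0))] i j := by
  have hfirst (k : Fin 3) : partialDeriv k (fun w : Fin 3 → ℝ => φ (w 0)) =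
      fun u => if k = 0 then deriv φ (u 0) else 0 := by
    ext u
    exact partialDeriv_comp_apply k 0 (hφ.differentiable (by simp) (u 0)).hasDerivAt
  have hsecond : partialDeriv i (fun u : Fin 3 → ℝ => if j = 0 then deriv φ (u 0) else 0) u =
      if i = 0 ∧ j = 0 then deriv (deriv φ) (u 0) else 0 := by
    by_cases hj : j = 0
    · simp only [hj, if_true, and_true]
      exact partialDeriv_comp_apply i 0 (hφ.differentiable_deriv_two (u 0)).hasDerivAt
    · simp [hj, partialDeriv_const]
  simp only [hessian, hfirst, hsecond, christoffel_warpedGram hh, Fin.sum_univ_three]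
  fin_cases i <;> fin_cases j <;> simp [warpedChristoffel] <;> ring

omit hh in
theorem gramDet_warpedGram (u a b : Fin 3 → ℝ) :
    innerAt (warpedGram h) u a a * innerAt (warpedGram h) u b b -
        innerAt (warpedGram h) u a b ^ 2 =
      Real.exp (2 * h (u 0)) * (crossProduct a b 1 ^ 2 + crossProduct a b 2 ^ 2) +
        Real.exp (2 * h (u 0)) ^ 2 * crossProduct a b 0 ^ 2 := by
  simp only [innerAt_warpedGram, cross_apply, Matrix.cons_val]
  ring

omit hh in
theorem gramDet_warpedGram_pos (u : Fin 3 → ℝ) {a b : Fin 3 → ℝ}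
    (hab : LinearIndependent ℝ ![a, b]) :
    0 < Real.exp (2 * h (u 0)) * (crossProduct a b 1 ^ 2 + crossProduct a b 2 ^ 2) +
      Real.exp (2 * h (u 0)) ^ 2 * crossProduct a b 0 ^ 2 := by
  obtain ⟨i, hi⟩ := Function.ne_iff.1 (crossProduct_ne_zero_iff_linearIndependent.2 hab)
  fin_cases i <;> simp only [Fin.zero_eta, Fin.mk_one, Fin.reduceFinMk, Pi.zero_apply] at hi <;>
    positivity

theorem sectional_warpedGram (u a b : Fin 3 → ℝ) :
    sectional (warpedGram h) u a b =
      (-(deriv (deriv h) (u 0) + deriv h (u 0) ^ 2) *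
          (Real.exp (2 * h (u 0)) * (crossProduct a b 1 ^ 2 + crossProduct a b 2 ^ 2)) +
        -deriv h (u 0) ^ 2 * (Real.exp (2 * h (u 0)) ^ 2 * crossProduct a b 0 ^ 2)) /
      (Real.exp (2 * h (u 0)) * (crossProduct a b 1 ^ 2 + crossProduct a b 2 ^ 2) +
        Real.exp (2 * h (u 0)) ^ 2 * crossProduct a b 0 ^ 2) := by
  rw [sectional, gramDet_warpedGram]
  congr 1
  simp [riemann_warpedGram hh, innerAt_warpedGram, warpedGram, warpedCurvature,
    Fin.sum_univ_three, Matrix.diagonal, cross_apply]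
  ring

theorem sectional_warpedGram_mem {u : Fin 3 → ℝ} {S : Set ℝ} (hS : Convex ℝ S)
    (hradial : -(deriv (deriv h) (u 0) + deriv h (u 0) ^ 2) ∈ S)
    (hfiber : -deriv h (u 0) ^ 2 ∈ S) {a b : Fin 3 → ℝ} (hab : LinearIndependent ℝ ![a, b]) :
    sectional (warpedGram h) u a b ∈ S := by
  have hpos := gramDet_warpedGram_pos (h := h) u hab
  rw [sectional_warpedGram hh]
  convert convex_iff_div.1 hS hradial hfiber (by positivity) (by positivity) hpos using 1
  simp only [smul_eq_mul]
  ring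

variable {g : LineTorusMetric} (hg : IsWarpedMetric g h)
include hg

theorem sectionalCurvatureMem_of_isWarpedMetric {S : Set ℝ} (hS : Convex ℝ S) (p : LineTorus)
    (hradial : -(deriv (deriv h) p.1 + deriv h p.1 ^ 2) ∈ S) (hfiber : -deriv h p.1 ^ 2 ∈ S) :
    SectionalCurvatureMem g p S := by
  obtain ⟨u, rfl⟩ := surjective_torusCoord p
  refine ⟨3, torusCoord, u, isCoordinatesAt_torusCoord u, fun a b hab => ?_⟩
  rw [show gram g torusCoord = warpedGram h from funext hg]
  exact sectional_warpedGram_mem hh hS hradial hfiber hab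

theorem sectionalCurvatureTendsto_of_tendsto_deriv {l : Filter ℝ} {a : ℝ}
    (ha : Tendsto (deriv h) l (𝓝 a)) (h0 : Tendsto (deriv (deriv h)) l (𝓝 0)) :
    SectionalCurvatureTendsto g l (-a ^ 2) := by
  have hfiber : Tendsto (fun r => -deriv h r ^ 2) l (𝓝 (-a ^ 2)) := (ha.pow 2).neg
  have hradial : Tendsto (fun r => -(deriv (deriv h) r + deriv h r ^ 2)) l (𝓝 (-a ^ 2)) := by
    simpa only [zero_add] using (h0.add (ha.pow 2)).neg
  intro δ hδ
  have hnhds : Set.Ioo (-a ^ 2 - δ) (-a ^ 2 + δ) ∈ 𝓝 (-a ^ 2) :=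
    Ioo_mem_nhds (by linarith) (by linarith)
  filter_upwards [hradial hnhds, hfiber hnhds] with r hr0 hr1 z w
  exact sectionalCurvatureMem_of_isWarpedMetric hh hg (convex_Ioo _ _) _ hr0 hr1

theorem isGradientRicciSoliton_of_isWarpedMetric {φ : ℝ → ℝ} (hφ : ContDiff ℝ ∞ φ)
    (hH : ∀ r, deriv (deriv h) r = deriv h r * deriv φ r - 2 * deriv h r ^ 2 + 1 / 2)
    (hF : ∀ r, deriv (deriv φ) r = 2 * deriv h r * deriv φ r - 2 * deriv h r ^ 2 + 1 / 2) :
    IsGradientRicciSoliton g (fun p => φ p.1) 1 := by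
  refine ⟨hφ.contMDiff.comp contMDiff_fst, fun p => ?_⟩
  obtain ⟨u, rfl⟩ := surjective_torusCoord p
  refine ⟨3, torusCoord, u, isCoordinatesAt_torusCoord u, fun i j => ?_⟩
  rw [show gram g torusCoord = warpedGram h from funext hg,
    show (fun p : LineTorus => φ p.1) ∘ torusCoord = fun w => φ (w 0) from rfl,
    ricci_warpedGram hh, hessian_warpedGram hh (contDiff_infty.1 hφ 2)]
  fin_cases i <;> fin_cases j <;> simp [warpedGram, hH, hF] <;> ring

end Curvature

/-! ### Unstable trajectories of quadratic vector fields -/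

section UnstableTrajectory

open Finset.HasAntidiagonal (antidiagonal sigmaAntidiagonalEquivProd)

theorem hasSum_bilinear_antidiagonal {E F G : Type*} [NormedAddCommGroup E] [NormedSpace ℝ E]
    [NormedAddCommGroup F] [NormedSpace ℝ F] [NormedAddCommGroup G] [NormedSpace ℝ G]
    [CompleteSpace E] [CompleteSpace F] [CompleteSpace G] (B : E →L[ℝ] F →L[ℝ] G)
    {f : ℕ → E} {g : ℕ → F} (hf : Summable fun n => ‖f n‖) (hg : Summable fun n => ‖g n‖) :
    HasSum (fun n => ∑ p ∈ antidiagonal n, B (f p.1) (g p.2))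
      (B (∑' n, f n) (∑' n, g n)) := by
  have hfg : Summable fun p : ℕ × ℕ => B (f p.1) (g p.2) := by
    refine .of_norm_bounded ((hf.mul_of_nonneg hg (fun _ => norm_nonneg _)
      (fun _ => norm_nonneg _)).mul_left ‖B‖) fun p => ?_
    rw [← mul_assoc]
    exact B.le_opNorm₂ _ _
  have htsum : ∑' p : ℕ × ℕ, B (f p.1) (g p.2) = B (∑' n, f n) (∑' n, g n) := by
    rw [hfg.tsum_prod, ← B.flip_apply, (B.flip _).map_tsum hf.of_norm]
    exact tsum_congr fun n => ((B (f n)).map_tsum hg.of_norm).symm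
  rw [← htsum]
  convert (sigmaAntidiagonalEquivProd.hasSum_iff.2 hfg.hasSum).sigma fun n => hasSum_fintype _
  rw [Finset.univ_eq_attach, ← Finset.sum_attach]
  rfl

variable {E : Type*} [NormedAddCommGroup E] [NormedSpace ℝ E]
  (A : E →L[ℝ] E) (B : E →L[ℝ] E →L[ℝ] E) (μ : ℝ) (v : E)

/-- The coefficients of the formal solution `∑ e^{(n+1)μr} aₙ` with `a₀ = v` of the equation
`u' = A u + B(u, u)`, where `A v = μ v`. -/
def unstableCoeff : ℕ → E
  | 0 => v
  | n + 1 => resolvent A ((n + 2 : ℝ) * μ)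
      (∑ i : Fin (n + 1), B (unstableCoeff i) (unstableCoeff (n - i)))

theorem unstableCoeff_succ (n : ℕ) :
    unstableCoeff A B μ v (n + 1) = resolvent A ((n + 2 : ℝ) * μ)
      (∑ p ∈ antidiagonal n, B (unstableCoeff A B μ v p.1) (unstableCoeff A B μ v p.2)) := by
  rw [unstableCoeff, Finset.Nat.sum_antidiagonal_eq_sum_range_succ
    (fun i j => B (unstableCoeff A B μ v i) (unstableCoeff A B μ v j)), Finset.sum_range]

variable {A B μ v}

theorem smul_unstableCoeff_zero (hv : A v = μ • v) :
    μ • unstableCoeff A B μ v 0 = A (unstableCoeff A B μ v 0) := by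
  rw [unstableCoeff, hv]

theorem smul_unstableCoeff_succ {n : ℕ} (hμ : (n + 2 : ℝ) * μ ∈ resolventSet ℝ A) :
    ((n + 2 : ℝ) * μ) • unstableCoeff A B μ v (n + 1) = A (unstableCoeff A B μ v (n + 1)) +
      ∑ p ∈ antidiagonal n, B (unstableCoeff A B μ v p.1) (unstableCoeff A B μ v p.2) := by
  rw [← sub_eq_iff_eq_add', unstableCoeff_succ]
  exact DFunLike.congr_fun (Ring.mul_inverse_cancel _ hμ) _

theorem tendsto_exp_mul_atBot (hμ : 0 < μ) : Tendsto (fun r => Real.exp (μ * r)) atBot (𝓝 0) :=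
  Real.tendsto_exp_atBot.comp (tendsto_id.const_mul_atBot hμ)

theorem hasDerivAt_exp_mul_pow_smul (n : ℕ) (a : E) (r : ℝ) :
    HasDerivAt (fun r => Real.exp (μ * r) ^ (n + 1) • a)
      (Real.exp (μ * r) ^ (n + 1) • ((n + 1 : ℝ) * μ) • a) r := by
  have hexp : HasDerivAt (fun r => Real.exp (μ * r)) (Real.exp (μ * r) * μ) r := by
    simpa using ((hasDerivAt_id r).const_mul μ).exp
  refine ((hexp.pow (n + 1)).smul_const a).congr_deriv ?_
  rw [smul_smul, pow_succ, Nat.add_sub_cancel]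
  push_cast
  ring_nf

theorem norm_exp_mul_pow_smul_unstableCoeff_le {K : ℝ}
    (hbound : ∀ n, ‖unstableCoeff A B μ v n‖ ≤ ‖v‖ * K ^ n) (n : ℕ) (r : ℝ) :
    ‖Real.exp (μ * r) ^ (n + 1) • unstableCoeff A B μ v n‖ ≤
      ‖v‖ * Real.exp (μ * r) * (K * Real.exp (μ * r)) ^ n := by
  rw [norm_smul, Real.norm_of_nonneg (by positivity)]
  calc _ ≤ Real.exp (μ * r) ^ (n + 1) * (‖v‖ * K ^ n) := by gcongr; exact hbound n
    _ = _ := by ring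

theorem summable_norm_unstableSeries {K : ℝ} (hK : 0 ≤ K)
    (hbound : ∀ n, ‖unstableCoeff A B μ v n‖ ≤ ‖v‖ * K ^ n) {r : ℝ}
    (hr : K * Real.exp (μ * r) < 1) :
    Summable fun n => ‖Real.exp (μ * r) ^ (n + 1) • unstableCoeff A B μ v n‖ :=
  .of_nonneg_of_le (fun _ => norm_nonneg _)
    (fun n => norm_exp_mul_pow_smul_unstableCoeff_le hbound n r)
    ((summable_geometric_of_lt_one (by positivity) hr).mul_left _)

variable [CompleteSpace E]

theorem exists_norm_resolvent_nat_mul_le (A : E →L[ℝ] E) (hμ : μ ≠ 0) :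
    ∃ C, 0 ≤ C ∧ ∀ n : ℕ, ‖resolvent A ((n + 2 : ℝ) * μ)‖ ≤ C / (n + 1) := by
  have hlim : Tendsto (fun n : ℕ => (n + 2 : ℝ) * μ) atTop (Bornology.cobounded ℝ) := by
    rw [← tendsto_norm_atTop_iff_cobounded]
    simp only [norm_mul]
    exact (tendsto_norm_atTop_atTop.comp
      (tendsto_natCast_atTop_atTop.atTop_add tendsto_const_nhds)).atTop_mul_const
      (norm_pos_iff.2 hμ)
  obtain ⟨C, hC, hbound⟩ := Asymptotics.bound_of_isBigO_nat_atTop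
    ((spectrum.resolvent_isBigO_inv A).comp_tendsto hlim)
  refine ⟨C / |μ|, by positivity, fun n => (hbound ?_).trans ?_⟩
  · exact inv_ne_zero (mul_ne_zero (by positivity) hμ)
  simp only [Function.comp_apply, norm_inv, norm_mul, Real.norm_eq_abs]
  rw [div_div, mul_comm |μ|, div_eq_mul_inv, abs_of_pos (by positivity : (0 : ℝ) < n + 2)]
  gcongr
  norm_num

variable (B v) in
theorem exists_norm_unstableCoeff_le (A : E →L[ℝ] E) (hμ : μ ≠ 0) :
    ∃ K, 0 ≤ K ∧ ∀ n, ‖unstableCoeff A B μ v n‖ ≤ ‖v‖ * K ^ n := by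
  obtain ⟨C, hC, hresolvent⟩ := exists_norm_resolvent_nat_mul_le A hμ
  refine ⟨C * ‖B‖ * ‖v‖, by positivity, fun n => ?_⟩
  induction n using Nat.strong_induction_on with
  | _ n ih =>
  rcases n with _ | n
  · simp [unstableCoeff]
  set K := C * ‖B‖ * ‖v‖ with hK
  have hterm (p : ℕ × ℕ) (hp : p ∈ antidiagonal n) :
      ‖B (unstableCoeff A B μ v p.1) (unstableCoeff A B μ v p.2)‖ ≤ ‖B‖ * ‖v‖ ^ 2 * K ^ n := by
    have hn := Finset.HasAntidiagonal.mem_antidiagonal.1 hp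
    calc _ ≤ ‖B‖ * ‖unstableCoeff A B μ v p.1‖ * ‖unstableCoeff A B μ v p.2‖ := B.le_opNorm₂ _ _
      _ ≤ ‖B‖ * (‖v‖ * K ^ p.1) * (‖v‖ * K ^ p.2) := by
        gcongr
        exacts [ih _ (by omega), ih _ (by omega)]
      _ = ‖B‖ * ‖v‖ ^ 2 * K ^ n := by rw [← hn]; ring
  calc ‖unstableCoeff A B μ v (n + 1)‖
      ≤ C / (n + 1) * ((n + 1) * (‖B‖ * ‖v‖ ^ 2 * K ^ n)) := by
        rw [unstableCoeff_succ]
        refine ContinuousLinearMap.le_of_opNorm_le_of_le _ (hresolvent n) ?_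
        simpa [nsmul_eq_mul] using norm_sum_le_of_le _ hterm
    _ = ‖v‖ * K ^ (n + 1) := by
        rw [pow_succ]
        field_simp
        rw [hK]
        ring

variable (A B μ v) in
/-- The solution `∑ e^{(n+1)μr} aₙ` of `u' = A u + B(u, u)`; the series converges for `r` close
to `-∞`. -/
def unstableSeries (r : ℝ) : E := ∑' n, Real.exp (μ * r) ^ (n + 1) • unstableCoeff A B μ v n

section

variable {K : ℝ} (hK : 0 ≤ K) (hbound : ∀ n, ‖unstableCoeff A B μ v n‖ ≤ ‖v‖ * K ^ n)
include hK hbound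

theorem hasDerivAt_unstableSeries (hμ : 0 < μ) {r r₀ : ℝ} (hr : r < r₀)
    (hr₀ : K * Real.exp (μ * r₀) < 1) :
    HasDerivAt (unstableSeries A B μ v)
      (∑' n : ℕ, Real.exp (μ * r) ^ (n + 1) • ((n + 1 : ℝ) * μ) • unstableCoeff A B μ v n) r := by
  have hsummable : Summable fun n : ℕ =>
      (n + 1 : ℝ) * μ * (‖v‖ * Real.exp (μ * r₀) * (K * Real.exp (μ * r₀)) ^ n) := by
    have hgeom : ‖K * Real.exp (μ * r₀)‖ < 1 := by rwa [Real.norm_of_nonneg (by positivity)]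
    refine (((summable_pow_mul_geometric_of_norm_lt_one 1 hgeom).add
      (summable_geometric_of_norm_lt_one hgeom)).mul_left
        (μ * (‖v‖ * Real.exp (μ * r₀)))).congr fun n => ?_
    ring
  refine hasDerivAt_tsum_of_isPreconnected hsummable isOpen_Iio isPreconnected_Iio
    (fun n y _ => hasDerivAt_exp_mul_pow_smul n _ y) (fun n y hy => ?_) hr
    (summable_norm_unstableSeries hK hbound (hr₀.trans_le' ?_)).of_norm hr
  · rw [smul_comm, norm_smul, Real.norm_of_nonneg (by positivity)]
    gcongr
    refine (norm_exp_mul_pow_smul_unstableCoeff_le hbound n y).trans ?_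
    gcongr <;> exact hy.le
  · gcongr

theorem hasSum_unstableSeries_ode (hv : A v = μ • v)
    (hresolvent : ∀ n : ℕ, (n + 2 : ℝ) * μ ∈ resolventSet ℝ A) {r : ℝ}
    (hr : K * Real.exp (μ * r) < 1) :
    HasSum (fun n : ℕ => Real.exp (μ * r) ^ (n + 1) • ((n + 1 : ℝ) * μ) • unstableCoeff A B μ v n)
      (A (unstableSeries A B μ v r) + B (unstableSeries A B μ v r) (unstableSeries A B μ v r)) := by
  have hsummable := summable_norm_unstableSeries hK hbound hr
  have hA := (A.hasSum hsummable.of_norm.hasSum)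
  have hB := hasSum_bilinear_antidiagonal B hsummable hsummable
  rw [← hasSum_nat_add_iff' 1] at hA ⊢
  convert hA.add hB using 1
  · ext n
    have hconv : ∑ p ∈ antidiagonal n, B (Real.exp (μ * r) ^ (p.1 + 1) • unstableCoeff A B μ v p.1)
        (Real.exp (μ * r) ^ (p.2 + 1) • unstableCoeff A B μ v p.2) = Real.exp (μ * r) ^ (n + 2) •
        ∑ p ∈ antidiagonal n, B (unstableCoeff A B μ v p.1) (unstableCoeff A B μ v p.2) := by
      rw [Finset.smul_sum]
      refine Finset.sum_congr rfl fun p hp => ?_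
      rw [map_smul, map_smul, smul_apply, smul_smul, ← pow_add,
        ← Finset.HasAntidiagonal.mem_antidiagonal.1 hp]
      ring_nf
    rw [hconv, map_smul, ← smul_add, ← smul_unstableCoeff_succ (hresolvent n)]
    push_cast
    ring_nf
  · simp only [Finset.sum_range_one, map_smul, ← smul_unstableCoeff_zero hv, unstableSeries]
    simp only [CharP.cast_eq_zero, zero_add, one_mul, add_sub_right_comm]

theorem tendsto_exp_neg_mul_smul_unstableSeries (hμ : 0 < μ) :
    Tendsto (fun r => Real.exp (-(μ * r)) • unstableSeries A B μ v r) atBot (𝓝 v) := by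
  have hterm (n : ℕ) (r : ℝ) :
      Real.exp (-(μ * r)) • Real.exp (μ * r) ^ (n + 1) • unstableCoeff A B μ v n =
        Real.exp (μ * r) ^ n • unstableCoeff A B μ v n := by
    rw [smul_smul, pow_succ', ← mul_assoc, ← Real.exp_add, neg_add_cancel, Real.exp_zero, one_mul]
  have hzero : ∑' n, (0 : ℝ) ^ n • unstableCoeff A B μ v n = v := by
    rw [tsum_eq_single 0 fun n hn => by rw [zero_pow hn, zero_smul], pow_zero, one_smul,
      unstableCoeff]
  have hsmall : ∀ᶠ r in atBot, K * Real.exp (μ * r) < 1 / 2 := by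
    refine ((tendsto_exp_mul_atBot hμ).const_mul K).eventually_lt_const ?_
    norm_num
  simp only [unstableSeries, ← tsum_const_smul'', hterm]
  rw [← congrArg 𝓝 hzero]
  refine tendsto_tsum_of_dominated_convergence (bound := fun n => ‖v‖ * (1 / 2) ^ n)
    (summable_geometric_two.mul_left _)
    (fun n => ((tendsto_exp_mul_atBot hμ).pow n).smul_const _) ?_
  filter_upwards [hsmall] with r hr n
  rw [norm_smul, Real.norm_of_nonneg (by positivity)]
  calc _ ≤ Real.exp (μ * r) ^ n * (‖v‖ * K ^ n) := by gcongr; exact hbound n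
    _ = ‖v‖ * (K * Real.exp (μ * r)) ^ n := by ring
    _ ≤ ‖v‖ * (1 / 2) ^ n := by gcongr

end

theorem exists_unstable_trajectory (hμ : 0 < μ) (hv : A v = μ • v)
    (hresolvent : ∀ n : ℕ, (n + 2 : ℝ) * μ ∈ resolventSet ℝ A) (B : E →L[ℝ] E →L[ℝ] E) :
    ∃ u : ℝ → E, (∀ᶠ r in atBot, HasDerivAt u (A (u r) + B (u r) (u r)) r) ∧
      Tendsto (fun r => Real.exp (-(μ * r)) • u r) atBot (𝓝 v) := by
  obtain ⟨K, hK, hbound⟩ := exists_norm_unstableCoeff_le B v A hμ.ne'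
  refine ⟨unstableSeries A B μ v, ?_, tendsto_exp_neg_mul_smul_unstableSeries hK hbound hμ⟩
  have hsmall : ∀ᶠ r in atBot, K * Real.exp (μ * r) < 1 := by
    refine ((tendsto_exp_mul_atBot hμ).const_mul K).eventually_lt_const ?_
    rw [mul_zero]
    exact one_pos
  obtain ⟨r₀, hr₀⟩ := hsmall.exists
  filter_upwards [eventually_lt_atBot r₀, hsmall] with r hr hKr
  rw [← (hasSum_unstableSeries_ode hK hbound hv hresolvent hKr).tsum_eq]
  exact hasDerivAt_unstableSeries hK hbound hμ hr hr₀

end UnstableTrajectory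

/-! ### Continuation of solutions -/

section Continuation

theorem lt_of_bootstrap {u : ℝ → ℝ} {T c : ℝ} (hu : ContinuousOn u (Set.Icc 0 T)) (h0 : u 0 < c)
    (hstep : ∀ t ∈ Set.Icc 0 T, (∀ s ∈ Set.Icc 0 t, u s ≤ c) → u t < c) :
    ∀ t ∈ Set.Icc 0 T, u t < c := by
  by_contra! hexit
  have hclosed : IsClosed (Set.Icc 0 T ∩ u ⁻¹' Set.Ici c) :=
    hu.preimage_isClosed_of_isClosed isClosed_Icc isClosed_Ici
  obtain ⟨t, ⟨ht, hct⟩, hmin⟩ :=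
    (isCompact_Icc.of_isClosed_subset hclosed Set.inter_subset_left).exists_isLeast hexit
  have ht0 : 0 ≠ t := by rintro rfl; exact h0.not_ge hct
  have hbefore : ∀ s ∈ Set.Ico 0 t, u s ≤ c := fun s hs =>
    le_of_not_ge fun hcs => hs.2.not_ge (hmin ⟨⟨hs.1, hs.2.le.trans ht.2⟩, hcs⟩)
  refine (hstep t ht fun s hs => ?_).not_ge hct
  rw [← closure_Ico ht0] at hs
  refine le_on_closure hbefore (hu.mono ?_) continuousOn_const hs
  rw [closure_Ico ht0]
  exact Set.Icc_subset_Icc_right ht.2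

theorem norm_lt_of_bootstrap {E : Type*} [NormedAddCommGroup E] {α : ℝ → E} {T c : ℝ}
    (hα : ContinuousOn α (Set.Icc (-T) T)) (h0 : ‖α 0‖ < c)
    (hstep : ∀ t ∈ Set.Icc 0 T, (∀ s ∈ Set.Icc (-t) t, ‖α s‖ ≤ c) → ‖α t‖ < c ∧ ‖α (-t)‖ < c) :
    ∀ t ∈ Set.Icc (-T) T, ‖α t‖ < c := by
  have hmax : ∀ t ∈ Set.Icc 0 T, max ‖α t‖ ‖α (-t)‖ < c := by
    refine lt_of_bootstrap ?_ (by simpa using h0) fun t ht hs => ?_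
    · refine (hα.mono fun t ht => ?_).norm.sup (hα.comp continuousOn_neg fun t ht => ?_).norm
      · exact ⟨by linarith [ht.1, ht.2], ht.2⟩
      · exact ⟨neg_le_neg ht.2, by linarith [ht.1, ht.2]⟩
    · refine max_lt_iff.2 (hstep t ht fun s hst => ?_)
      have hs' := max_le_iff.1 (hs |s| ⟨abs_nonneg s, abs_le.2 hst⟩)
      rcases abs_choice s with h | h <;> rw [h] at hs'
      exacts [hs'.1, by simpa using hs'.2]
  intro t ht
  have ht' := max_lt_iff.1 (hmax |t| ⟨abs_nonneg t, abs_le.2 ht⟩)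
  rcases abs_choice t with h | h <;> rw [h] at ht'
  exacts [ht'.1, by simpa using ht'.2]

theorem pos_of_hasDerivAt_linear {u a b : ℝ → ℝ} {T : ℝ}
    (hu : ∀ t ∈ Set.Icc 0 T, HasDerivAt u (a t * u t + b t) t)
    (ha : ContinuousOn a (Set.Icc 0 T)) (hb : ∀ t ∈ Set.Icc 0 T, 0 ≤ b t) (h0 : 0 < u 0) :
    ∀ t ∈ Set.Icc 0 T, 0 < u t := by
  intro t ht
  have hT : 0 ≤ T := ht.1.trans ht.2
  set A : ℝ → ℝ := fun s => ∫ r in 0..s, Set.IccExtend hT ((Set.Icc 0 T).domRestrict a) r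
  have hA : ∀ s ∈ Set.Icc 0 T, HasDerivAt A (a s) s := fun s hs => by
    have hcont := (continuousOn_iff_continuous_domRestrict.1 ha).Icc_extend' (h := hT)
    simpa only [Set.IccExtend_of_mem hT _ hs, Set.domRestrict_apply] using
      (hcont.integral_hasStrictDerivAt 0 s).hasDerivAt
  have hderiv : ∀ s ∈ Set.Icc 0 T,
      HasDerivAt (fun s => u s * Real.exp (-A s)) (b s * Real.exp (-A s)) s := fun s hs =>
    ((hu s hs).mul (hA s hs).fun_neg.exp).congr_deriv (by ring)
  have hmono : MonotoneOn (fun s => u s * Real.exp (-A s)) (Set.Icc 0 T) :=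
    monotoneOn_of_hasDerivWithinAt_nonneg (convex_Icc 0 T) (HasDerivAt.continuousOn hderiv)
      (fun s hs => (hderiv s (interior_subset hs)).hasDerivWithinAt)
      fun s hs => mul_nonneg (hb s (interior_subset hs)) (Real.exp_pos _).le
  have hpos : 0 < u t * Real.exp (-A t) := calc
    0 < u 0 * Real.exp (-A 0) := mul_pos h0 (Real.exp_pos _)
    _ ≤ u t * Real.exp (-A t) := hmono ⟨le_rfl, hT⟩ ht ht.1
  exact pos_of_mul_pos_left hpos (Real.exp_pos _).le

variable {E : Type*} [NormedAddCommGroup E] [NormedSpace ℝ E] {V : E → E}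

theorem eqOn_Icc_of_hasDerivAt_of_eq_right (hV : ContDiff ℝ 1 V) {α β : ℝ → E} {a b : ℝ}
    (hα : ∀ t ∈ Set.Icc a b, HasDerivAt α (V (α t)) t)
    (hβ : ∀ t ∈ Set.Icc a b, HasDerivAt β (V (β t)) t) (hb : α b = β b) :
    Set.EqOn α β (Set.Icc a b) := by
  have hcompact : IsCompact (α '' Set.Icc a b ∪ β '' Set.Icc a b) :=
    (isCompact_Icc.image_of_continuousOn (HasDerivAt.continuousOn hα)).union
      (isCompact_Icc.image_of_continuousOn (HasDerivAt.continuousOn hβ))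
  obtain ⟨K, hK⟩ :=
    hV.locallyLipschitz.locallyLipschitzOn.exists_lipschitzOnWith_of_compact hcompact
  have hsub : Set.Ioc a b ⊆ Set.Icc a b := Set.Ioc_subset_Icc_self
  exact ODE_solution_unique_of_mem_Icc_left (v := fun _ => V) (fun _ _ => hK)
    (HasDerivAt.continuousOn hα) (fun t ht => (hα t (hsub ht)).hasDerivWithinAt)
    (fun t ht => .inl ⟨t, hsub ht, rfl⟩)
    (HasDerivAt.continuousOn hβ) (fun t ht => (hβ t (hsub ht)).hasDerivWithinAt)
    (fun t ht => .inr ⟨t, hsub ht, rfl⟩) hb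

theorem exists_hasDerivAt_of_lipschitzWith [CompleteSpace E] {K L : NNReal}
    (hK : LipschitzWith K V) (hL : ∀ z, ‖V z‖ ≤ L) (x : E) (T : ℝ) :
    ∃ α : ℝ → E, α 0 = x ∧ ∀ t ∈ Set.Icc (-T) T, HasDerivAt α (V (α t)) t := by
  obtain ⟨S, hTS⟩ : ∃ S : NNReal, |T| < S := ⟨Real.nnabs T + 1, by simp⟩
  have h0 : (0 : ℝ) ∈ Set.Icc (-S : ℝ) S := ⟨neg_nonpos.2 S.2, S.2⟩
  have hPL : IsPicardLindelof (fun _ => V) (⟨0, h0⟩ : Set.Icc (-S : ℝ) S) x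
      (L * S) 0 L K := by
    refine .of_time_independent (fun z _ => hL z) hK.lipschitzOnWith (le_of_eq ?_)
    rw [sub_zero, zero_sub, neg_neg, max_self, NNReal.coe_zero, sub_zero, NNReal.coe_mul]
  obtain ⟨α, hα0, hα⟩ := hPL.exists_eq_forall_mem_Icc_hasDerivWithinAt₀
  have hT : T < S := (le_abs_self T).trans_lt hTS
  exact ⟨α, hα0, fun t ht => (hα t ⟨by linarith [ht.1], by linarith [ht.2]⟩).hasDerivAt
    (Icc_mem_nhds (by linarith [ht.1]) (by linarith [ht.2]))⟩

variable [FiniteDimensional ℝ E]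

theorem exists_lipschitzWith_eqOn_closedBall (hV : ContDiff ℝ 1 V) {R : ℝ} (hR : 0 < R) :
    ∃ (W : E → E) (K L : NNReal), LipschitzWith K W ∧ (∀ z, ‖W z‖ ≤ L) ∧
      Set.EqOn W V (Metric.closedBall 0 R) := by
  let χ : ContDiffBump (0 : E) := ⟨R, R + 1, hR, lt_add_one R⟩
  have hW : ContDiff ℝ 1 fun z => χ z • V z := χ.contDiff.smul hV
  have hsupp : HasCompactSupport fun z => χ z • V z := χ.hasCompactSupport.smul_right
  obtain ⟨K, hK⟩ := hW.lipschitzWith_of_hasCompactSupport hsupp one_ne_zero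
  obtain ⟨L, hL⟩ := hsupp.exists_bound_of_continuous hW.continuous
  refine ⟨_, K, L.toNNReal, hK, fun z => (hL z).trans (Real.le_coe_toNNReal L), fun z hz => ?_⟩
  simp only [χ.one_of_mem_closedBall hz, one_smul]

theorem exists_hasDerivAt_Icc_of_norm_le (hV : ContDiff ℝ 1 V) {x : E} {T R : ℝ}
    (hR : ∀ t ∈ Set.Icc 0 T, ∀ α : ℝ → E, α 0 = x →
      (∀ s ∈ Set.Icc (-t) t, HasDerivAt α (V (α s)) s) → ‖α t‖ ≤ R ∧ ‖α (-t)‖ ≤ R) :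
    ∃ α : ℝ → E, α 0 = x ∧ ∀ t ∈ Set.Icc (-T) T, HasDerivAt α (V (α t)) t := by
  obtain ⟨R', hR', hx, hR'pos⟩ : ∃ R', R < R' ∧ ‖x‖ < R' ∧ 0 < R' :=
    ⟨max R ‖x‖ + 1, (le_max_left _ _).trans_lt (lt_add_one _),
      (le_max_right _ _).trans_lt (lt_add_one _), by positivity⟩
  obtain ⟨W, K, L, hK, hL, hWV⟩ := exists_lipschitzWith_eqOn_closedBall hV hR'pos
  have : CompleteSpace E := FiniteDimensional.complete ℝ E
  obtain ⟨α, hα0, hα⟩ := exists_hasDerivAt_of_lipschitzWith hK hL x T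
  have hV_of_norm_le : ∀ t ∈ Set.Icc (-T) T, ‖α t‖ ≤ R' → HasDerivAt α (V (α t)) t :=
    fun t ht hnorm => hWV (mem_closedBall_zero_iff.2 hnorm) ▸ hα t ht
  have hbound : ∀ t ∈ Set.Icc (-T) T, ‖α t‖ < R' := by
    refine norm_lt_of_bootstrap (HasDerivAt.continuousOn hα) (hα0 ▸ hx) fun t ht hs => ?_
    have hsol : ∀ s ∈ Set.Icc (-t) t, HasDerivAt α (V (α s)) s := fun s hst =>
      hV_of_norm_le s (Set.Icc_subset_Icc (neg_le_neg ht.2) ht.2 hst) (hs s hst)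
    exact (hR t ht α hα0 hsol).imp hR'.trans_le' hR'.trans_le'
  exact ⟨α, hα0, fun t ht => hV_of_norm_le t ht (hbound t ht).le⟩

theorem exists_hasDerivAt_of_norm_le (hV : ContDiff ℝ 1 V) {x : E}
    (hR : ∀ T : ℝ, ∃ R : ℝ, ∀ t ∈ Set.Icc 0 T, ∀ α : ℝ → E, α 0 = x →
      (∀ s ∈ Set.Icc (-t) t, HasDerivAt α (V (α s)) s) → ‖α t‖ ≤ R ∧ ‖α (-t)‖ ≤ R) :
    ∃ γ : ℝ → E, γ 0 = x ∧ ∀ t, HasDerivAt γ (V (γ t)) t := by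
  have : CompleteSpace E := FiniteDimensional.complete ℝ E
  have hbundle : ContMDiff 𝓘(ℝ, E) (𝓘(ℝ, E).tangent) 1
      (fun z => (⟨z, V z⟩ : TangentBundle 𝓘(ℝ, E) E)) := contMDiff_vectorSpace_iff_contDiff.2 hV
  obtain ⟨γ, hγ0, hγ⟩ := (exists_isMIntegralCurve_iff_exists_isMIntegralCurveOn_Ioo hbundle x).2
    fun T => by
      obtain ⟨R, hR⟩ := hR T
      obtain ⟨α, hα0, hα⟩ := exists_hasDerivAt_Icc_of_norm_le hV hR
      exact ⟨α, hα0, fun t ht =>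
        (hα t (Set.Ioo_subset_Icc_self ht)).hasFDerivAt.hasMFDerivAt.hasMFDerivWithinAt⟩
  exact ⟨γ, hγ0, fun t => (hγ t).hasFDerivAt⟩

theorem exists_hasDerivAt_extension_of_norm_le (hV : ContDiff ℝ 1 V) {β : ℝ → E}
    (hβ : ∀ t ≤ 0, HasDerivAt β (V (β t)) t)
    (hR : ∀ T : ℝ, ∃ R : ℝ, ∀ t ∈ Set.Icc 0 T, ∀ α : ℝ → E, α 0 = β 0 →
      (∀ s ∈ Set.Icc 0 t, HasDerivAt α (V (α s)) s) → ‖α t‖ ≤ R) :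
    ∃ γ : ℝ → E, (∀ t, HasDerivAt γ (V (γ t)) t) ∧ Set.EqOn γ β (Set.Iic 0) := by
  have heq : ∀ t ≥ 0, ∀ α : ℝ → E, α 0 = β 0 →
      (∀ s ∈ Set.Icc (-t) 0, HasDerivAt α (V (α s)) s) → α (-t) = β (-t) := fun t ht α h0 hα =>
    eqOn_Icc_of_hasDerivAt_of_eq_right hV hα (fun s hs => hβ s hs.2) h0 ⟨le_rfl, neg_nonpos.2 ht⟩
  obtain ⟨γ, hγ0, hγ⟩ := exists_hasDerivAt_of_norm_le hV (x := β 0) fun T => by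
    obtain ⟨R, hR⟩ := hR T
    obtain ⟨R', hR'⟩ := isCompact_Icc.exists_bound_of_continuousOn (s := Set.Icc (-T) 0)
      (HasDerivAt.continuousOn fun t ht => hβ t ht.2)
    refine ⟨max R R', fun t ht α h0 hα => ⟨?_, ?_⟩⟩
    · exact le_max_of_le_left
        (hR t ht α h0 fun s hs => hα s ⟨by linarith [hs.1, ht.1], hs.2⟩)
    · rw [heq t ht.1 α h0 fun s hs => hα s ⟨hs.1, hs.2.trans ht.1⟩]
      exact le_max_of_le_right (hR' _ ⟨neg_le_neg ht.2, neg_nonpos.2 ht.1⟩)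
  exact ⟨γ, hγ, fun t ht => by simpa using heq (-t) (neg_nonneg.2 ht) γ hγ0 fun s _ => hγ s⟩

end Continuation

/-! ### The saddle point -/

section Saddle

/-- The linear map `T` for which the planar system reads `z' = z.1 • T z + (1/2, 1/2)`. -/
def solitonLinear : ℝ × ℝ →L[ℝ] ℝ × ℝ :=
  (ContinuousLinearMap.snd ℝ ℝ ℝ - (2 : ℝ) • ContinuousLinearMap.fst ℝ ℝ ℝ).prod
    ((2 : ℝ) • ContinuousLinearMap.snd ℝ ℝ ℝ - (2 : ℝ) • ContinuousLinearMap.fst ℝ ℝ ℝ)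

/-- The linearization of the planar system at the saddle point `(1/2, 0)`, with characteristic
polynomial `X ^ 2 + X - 1`. -/
def saddleLinearization : ℝ × ℝ →L[ℝ] ℝ × ℝ :=
  (1 / 2 : ℝ) • solitonLinear - (ContinuousLinearMap.fst ℝ ℝ ℝ).smulRight (1, 1)

theorem solitonLinear_apply (z : ℝ × ℝ) :
    solitonLinear z = (z.2 - 2 * z.1, 2 * z.2 - 2 * z.1) := rfl

theorem saddleLinearization_apply (z : ℝ × ℝ) :
    saddleLinearization z = (z.2 / 2 - 2 * z.1, z.2 - 2 * z.1) := by
  ext <;> simp [saddleLinearization, solitonLinear_apply] <;> ring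

theorem solitonField_saddle_add (u : ℝ × ℝ) :
    solitonField ((1 / 2, 0) + u) = saddleLinearization u + u.1 • solitonLinear u := by
  ext <;> simp [solitonField, saddleLinearization_apply, solitonLinear_apply] <;> ring

theorem hasFDerivAt_solitonField_saddle :
    HasFDerivAt solitonField saddleLinearization (1 / 2, 0) := by
  have hquad : HasFDerivAt (fun u : ℝ × ℝ => saddleLinearization u + u.1 • solitonLinear u)
      saddleLinearization 0 :=
    (saddleLinearization.hasFDerivAt.add
      (hasFDerivAt_fst.smul solitonLinear.hasFDerivAt)).congr_fderiv (by ext <;> simp)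
  have hshift : HasFDerivAt (fun z : ℝ × ℝ => z - (1 / 2, 0)) (.id ℝ (ℝ × ℝ)) (1 / 2, 0) :=
    hasFDerivAt_sub_const _
  have hcomp := HasFDerivAt.comp (1 / 2, 0) (by rwa [sub_self]) hshift
  refine hcomp.congr_of_eventuallyEq (.of_forall fun z => ?_)
  rw [Function.comp_apply, ← solitonField_saddle_add, add_sub_cancel]

variable {m : ℝ}

theorem saddleLinearization_eigenvector (hm : m ^ 2 + m = 1) :
    saddleLinearization (1, 2 * (2 + m)) = m • (1, 2 * (2 + m)) := by
  rw [saddleLinearization_apply, Prod.smul_mk, smul_eq_mul, smul_eq_mul]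
  congr 1
  · ring
  · linear_combination -2 * hm

theorem hasEigenvalue_saddleLinearization (hm : m ^ 2 + m = 1) :
    Module.End.HasEigenvalue (saddleLinearization : ℝ × ℝ →ₗ[ℝ] ℝ × ℝ) m :=
  Module.End.hasEigenvalue_of_hasEigenvector
    ⟨Module.End.mem_eigenspace_iff.2 (saddleLinearization_eigenvector hm), by simp⟩

theorem saddleLinearization_sq_add_self : saddleLinearization ^ 2 + saddleLinearization = 1 := by
  refine ContinuousLinearMap.ext fun z => Prod.ext ?_ ?_ <;>
  · simp only [sq, add_apply, mul_apply_eq_comp, saddleLinearization_apply,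
      Prod.mk_add_mk, one_apply_eq_self]
    ring

theorem mem_resolventSet_saddleLinearization (hm : m ^ 2 + m ≠ 1) :
    m ∈ resolventSet ℝ saddleLinearization := by
  by_contra hspec
  have himage := spectrum.subset_polynomial_aeval saddleLinearization
    (Polynomial.X ^ 2 + Polynomial.X) ⟨m, hspec, rfl⟩
  refine hm ?_
  simpa [saddleLinearization_sq_add_self] using himage

theorem isSaddlePoint_solitonField : IsSaddlePoint solitonField (1 / 2, 0) := by
  refine ⟨by simpa using solitonField_saddle_add 0,
    hasFDerivAt_solitonField_saddle.differentiableAt,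
    -Real.goldenRatio, -Real.goldenConj, neg_lt_zero.2 Real.goldenRatio_pos,
    neg_pos.2 Real.goldenConj_neg, ?_, ?_⟩ <;>
  rw [hasFDerivAt_solitonField_saddle.fderiv] <;>
  apply hasEigenvalue_saddleLinearization
  · linear_combination Real.goldenRatio_sq
  · linear_combination Real.goldenConj_sq

end Saddle

/-! ### The pinched region -/

/-- The points `(H, F)` of the phase plane at which the curvatures `-H ^ 2` and `-(H' + H ^ 2)` lie
in `(-1/4, 0)` and `H` decreases, where `H' = H * F - 2 * H ^ 2 + 1 / 2` is taken along the planar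
system. -/
structure IsPinched (H F : ℝ) : Prop where
  pos : 0 < H
  lt_half : H < 1 / 2
  deriv_neg : H * F - 2 * H ^ 2 + 1 / 2 < 0
  deriv_add_sq_pos : 0 < H * F - H ^ 2 + 1 / 2

theorem snd_neg_of_deriv_nonpos {H F : ℝ} (hpos : 0 < H) (hlt : H < 1 / 2)
    (hderiv : H * F - 2 * H ^ 2 + 1 / 2 ≤ 0) : F < 0 :=
  neg_of_mul_neg_right (by nlinarith) hpos.le

namespace IsPinched

variable {H F : ℝ}

theorem snd_neg (hp : IsPinched H F) : F < 0 :=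
  snd_neg_of_deriv_nonpos hp.pos hp.lt_half hp.deriv_neg.le

theorem sq_lt (hp : IsPinched H F) : H ^ 2 < 1 / 4 := by
  nlinarith [hp.pos, hp.lt_half]

end IsPinched

theorem hasDerivAt_prodMk_iff {E G : Type*} [NormedAddCommGroup E] [NormedSpace ℝ E]
    [NormedAddCommGroup G] [NormedSpace ℝ G] {u : ℝ → E} {w : ℝ → G} {u' : E} {w' : G} {t : ℝ} :
    HasDerivAt (fun r => (u r, w r)) (u', w') t ↔ HasDerivAt u u' t ∧ HasDerivAt w w' t :=
  ⟨fun h => ⟨by simpa using h.hasFDerivAt.fst.hasDerivAt,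
      by simpa using h.hasFDerivAt.snd.hasDerivAt⟩,
    fun h => h.1.prodMk h.2⟩

section ForwardInvariance

variable {H F : ℝ → ℝ} {T : ℝ}

theorem fst_pos_of_hasDerivAt
    (hH : ∀ t ∈ Set.Icc 0 T, HasDerivAt H (H t * F t - 2 * H t ^ 2 + 1 / 2) t)
    (hF : ContinuousOn F (Set.Icc 0 T)) (h0 : 0 < H 0) : ∀ t ∈ Set.Icc 0 T, 0 < H t := by
  have hHcont : ContinuousOn H (Set.Icc 0 T) := HasDerivAt.continuousOn hH
  exact pos_of_hasDerivAt_linear (a := fun t => F t - 2 * H t) (b := fun _ => 1 / 2)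
    (fun t ht => (hH t ht).congr_deriv (by ring)) (by fun_prop) (fun _ _ => by norm_num) h0

theorem fst_lt_half_of_deriv_nonpos
    (hH : ∀ t ∈ Set.Icc 0 T, HasDerivAt H (H t * F t - 2 * H t ^ 2 + 1 / 2) t)
    (hderiv : ∀ t ∈ Set.Icc 0 T, H t * F t - 2 * H t ^ 2 + 1 / 2 ≤ 0) (h0 : H 0 < 1 / 2) :
    ∀ t ∈ Set.Icc 0 T, H t < 1 / 2 := by
  intro t ht
  have hanti : AntitoneOn H (Set.Icc 0 T) :=
    antitoneOn_of_hasDerivWithinAt_nonpos (convex_Icc 0 T) (HasDerivAt.continuousOn hH)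
      (fun s hs => (hH s (interior_subset hs)).hasDerivWithinAt)
      fun s hs => hderiv s (interior_subset hs)
  exact (hanti ⟨le_rfl, ht.1.trans ht.2⟩ ht ht.1).trans_lt h0

variable (hH : ∀ t ∈ Set.Icc 0 T, HasDerivAt H (H t * F t - 2 * H t ^ 2 + 1 / 2) t)
  (hF : ∀ t ∈ Set.Icc 0 T, HasDerivAt F (2 * H t * F t - 2 * H t ^ 2 + 1 / 2) t)

include hH hF

theorem deriv_add_sq_pos_of_hasDerivAt (hpos : ∀ t ∈ Set.Icc 0 T, 0 ≤ H t)
    (h0 : 0 < H 0 * F 0 - H 0 ^ 2 + 1 / 2) :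
    ∀ t ∈ Set.Icc 0 T, 0 < H t * F t - H t ^ 2 + 1 / 2 := by
  have hHcont : ContinuousOn H (Set.Icc 0 T) := HasDerivAt.continuousOn hH
  have hFcont : ContinuousOn F (Set.Icc 0 T) := HasDerivAt.continuousOn hF
  exact pos_of_hasDerivAt_linear (a := fun t => F t - H t) (b := fun t => H t ^ 3)
    (fun t ht => ((((hH t ht).mul (hF t ht)).sub ((hH t ht).pow 2)).add_const _).congr_deriv
      (by push_cast; ring))
    (by fun_prop) (fun t ht => pow_nonneg (hpos t ht) 3) h0

theorem deriv_neg_of_snd_nonpos (hFneg : ∀ t ∈ Set.Icc 0 T, F t ≤ 0)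
    (h0 : H 0 * F 0 - 2 * H 0 ^ 2 + 1 / 2 < 0) :
    ∀ t ∈ Set.Icc 0 T, H t * F t - 2 * H t ^ 2 + 1 / 2 < 0 := by
  have hHcont : ContinuousOn H (Set.Icc 0 T) := HasDerivAt.continuousOn hH
  have hFcont : ContinuousOn F (Set.Icc 0 T) := HasDerivAt.continuousOn hF
  intro t ht
  refine neg_pos.1 (pos_of_hasDerivAt_linear (u := fun t => -(H t * F t - 2 * H t ^ 2 + 1 / 2))
    (a := fun t => F t - 3 * H t) (b := fun t => H t ^ 2 * -F t)
    (fun s hs => ?_) (by fun_prop)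
    (fun s hs => mul_nonneg (sq_nonneg _) (neg_nonneg.2 (hFneg s hs))) (neg_pos.2 h0) t ht)
  exact ((((hH s hs).mul (hF s hs)).sub (((hH s hs).pow 2).const_mul 2)).add_const
    _).fun_neg.congr_deriv (by push_cast; ring)

theorem isPinched_of_hasDerivAt (h0 : IsPinched (H 0) (F 0)) :
    ∀ t ∈ Set.Icc 0 T, IsPinched (H t) (F t) := by
  have hHcont : ContinuousOn H (Set.Icc 0 T) := HasDerivAt.continuousOn hH
  have hFcont : ContinuousOn F (Set.Icc 0 T) := HasDerivAt.continuousOn hF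
  have hpos := fst_pos_of_hasDerivAt hH hFcont h0.pos
  have hsub : ∀ t ∈ Set.Icc 0 T, Set.Icc 0 t ⊆ Set.Icc 0 T :=
    fun t ht => Set.Icc_subset_Icc_right ht.2
  have hderiv : ∀ t ∈ Set.Icc 0 T, H t * F t - 2 * H t ^ 2 + 1 / 2 < 0 := by
    refine lt_of_bootstrap (by fun_prop) h0.deriv_neg fun t ht hle => ?_
    have hHt := fun s hs => hH s (hsub t ht hs)
    have hlt := fst_lt_half_of_deriv_nonpos hHt hle h0.lt_half
    have hFneg : ∀ s ∈ Set.Icc 0 t, F s ≤ 0 := fun s hs =>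
      (snd_neg_of_deriv_nonpos (hpos s (hsub t ht hs)) (hlt s hs) (hle s hs)).le
    exact deriv_neg_of_snd_nonpos hHt (fun s hs => hF s (hsub t ht hs)) hFneg h0.deriv_neg
      t ⟨ht.1, le_rfl⟩
  have hlt := fst_lt_half_of_deriv_nonpos hH (fun t ht => (hderiv t ht).le) h0.lt_half
  have hcurv :=
    deriv_add_sq_pos_of_hasDerivAt hH hF (fun t ht => (hpos t ht).le) h0.deriv_add_sq_pos
  exact fun t ht => ⟨hpos t ht, hlt t ht, hderiv t ht, hcurv t ht⟩

end ForwardInvariance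

theorem norm_le_of_isPinched {α : ℝ → ℝ × ℝ} {T : ℝ} (hT : 0 ≤ T)
    (hα : ∀ t ∈ Set.Icc 0 T, HasDerivAt α (solitonField (α t)) t)
    (hp : ∀ t ∈ Set.Icc 0 T, IsPinched (α t).1 (α t).2) : ‖α T‖ ≤ |(α 0).2| + T + 1 := by
  have hderiv : ∀ t ∈ Set.Icc 0 T, HasDerivAt (fun t => (α t).2 + t / 2)
      (2 * (α t).1 * (α t).2 - 2 * (α t).1 ^ 2 + 1 / 2 + 1 / 2) t := fun t ht =>
    (hasDerivAt_prodMk_iff.1 (hα t ht)).2.add ((hasDerivAt_id t).div_const 2)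
  have hmono : MonotoneOn (fun t => (α t).2 + t / 2) (Set.Icc 0 T) :=
    monotoneOn_of_hasDerivWithinAt_nonneg (convex_Icc 0 T) (HasDerivAt.continuousOn hderiv)
      (fun t ht => (hderiv t (interior_subset ht)).hasDerivWithinAt)
      fun t ht => by linarith [(hp t (interior_subset ht)).deriv_add_sq_pos]
  have hlower : (α 0).2 + 0 / 2 ≤ (α T).2 + T / 2 := hmono ⟨le_rfl, hT⟩ ⟨hT, le_rfl⟩ hT
  have hpT := hp T ⟨hT, le_rfl⟩
  refine norm_prod_le_iff.2 ⟨abs_le.2 ⟨?_, ?_⟩, abs_le.2 ⟨?_, ?_⟩⟩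
  · linarith [hpT.pos, abs_nonneg (α 0).2]
  · linarith [hpT.lt_half, abs_nonneg (α 0).2]
  · linarith [neg_abs_le (α 0).2]
  · linarith [hpT.snd_neg, abs_nonneg (α 0).2]

theorem eventually_isPinched_saddle_add {u : ℝ → ℝ × ℝ} {μ : ℝ} {v : ℝ × ℝ} (hμ : 0 < μ)
    (hv : saddleLinearization v = μ • v) (hv_neg : v.1 < 0)
    (hu : Tendsto (fun r => Real.exp (-(μ * r)) • u r) atBot (𝓝 v)) :
    ∀ᶠ r in atBot, IsPinched (1 / 2 + (u r).1) (u r).2 := by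
  have hexp_mul : ∀ r, Real.exp (μ * r) • Real.exp (-(μ * r)) • u r = u r := fun r => by
    rw [smul_smul, ← Real.exp_add, add_neg_cancel, Real.exp_zero, one_smul]
  have hu0 : Tendsto u atBot (𝓝 0) := by
    simpa only [hexp_mul, zero_smul] using (tendsto_exp_mul_atBot hμ).smul hu
  have hfst : Tendsto (fun r => (u r).1) atBot (𝓝 0) := hu0.fst_nhds
  have hsnd : Tendsto (fun r => (u r).2) atBot (𝓝 0) := hu0.snd_nhds
  have hfst_neg : ∀ᶠ r in atBot, Real.exp (-(μ * r)) * (u r).1 < 0 :=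
    hu.fst_nhds.eventually_lt_const hv_neg
  have hcurv : Tendsto (fun r => (1 / 2 + (u r).1) * (u r).2 - (1 / 2 + (u r).1) ^ 2 + 1 / 2)
      atBot (𝓝 ((1 / 2 + 0) * 0 - (1 / 2 + 0) ^ 2 + 1 / 2)) :=
    (((hfst.const_add _).mul hsnd).sub ((hfst.const_add _).pow 2)).add_const _
  have hfield : Tendsto (fun r => Real.exp (-(μ * r)) • solitonField ((1 / 2, 0) + u r)) atBot
      (𝓝 (μ • v)) := by
    have hlim := ((saddleLinearization.continuous.tendsto v).comp hu).add
      (hfst.smul ((solitonLinear.continuous.tendsto v).comp hu))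
    rw [hv, zero_smul, add_zero] at hlim
    refine hlim.congr fun r => ?_
    rw [solitonField_saddle_add, smul_add, smul_comm, Function.comp_apply, Function.comp_apply,
      map_smul, map_smul]
  have hderiv_neg : ∀ᶠ r in atBot,
      Real.exp (-(μ * r)) * (solitonField ((1 / 2, 0) + u r)).1 < 0 :=
    hfield.fst_nhds.eventually_lt_const (mul_neg_of_pos_of_neg hμ hv_neg)
  filter_upwards [hfst.eventually_const_lt (show -(1 / 2 : ℝ) < 0 by norm_num), hfst_neg,
    hcurv.eventually_const_lt (u := 0) (by norm_num), hderiv_neg] with r hpos hlt hcurv hderiv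
  have hneg := neg_of_mul_neg_right hlt (Real.exp_pos _).le
  refine ⟨by linarith, by linarith, ?_, hcurv⟩
  simpa [solitonField] using neg_of_mul_neg_right hderiv (Real.exp_pos _).le

/-- A complete trajectory `(H, F)` of the planar system inside the pinched region: the pair
`(h', f')` of a complete soliton with curvatures in `(-1/4, 0)`. -/
structure IsPinchedTrajectory (H F : ℝ → ℝ) : Prop where
  hasDerivAt : ∀ t, HasDerivAt (fun t => (H t, F t)) (solitonField (H t, F t)) t
  isPinched : ∀ t, IsPinched (H t) (F t)

theorem contDiff_solitonField {n : WithTop ℕ∞} : ContDiff ℝ n solitonField := by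
  unfold solitonField
  fun_prop

theorem exists_isPinchedTrajectory_of_hasDerivAt {β : ℝ → ℝ × ℝ}
    (hβ : ∀ t ≤ 0, HasDerivAt β (solitonField (β t)) t)
    (hp : ∀ t ≤ 0, IsPinched (β t).1 (β t).2) : ∃ H F, IsPinchedTrajectory H F := by
  have hforward : ∀ T, ∀ α : ℝ → ℝ × ℝ, α 0 = β 0 →
      (∀ t ∈ Set.Icc 0 T, HasDerivAt α (solitonField (α t)) t) →
      ∀ t ∈ Set.Icc 0 T, IsPinched (α t).1 (α t).2 := fun T α h0 hα =>
    isPinched_of_hasDerivAt (fun t ht => (hasDerivAt_prodMk_iff.1 (hα t ht)).1)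
      (fun t ht => (hasDerivAt_prodMk_iff.1 (hα t ht)).2) (h0 ▸ hp 0 le_rfl)
  obtain ⟨γ, hγ, hγβ⟩ := exists_hasDerivAt_extension_of_norm_le contDiff_solitonField hβ fun T =>
    ⟨|(β 0).2| + T + 1, fun t ht α h0 hα =>
      (norm_le_of_isPinched ht.1 hα (hforward t α h0 hα)).trans (by rw [h0]; linarith [ht.2])⟩
  refine ⟨fun t => (γ t).1, fun t => (γ t).2, hγ, fun t => ?_⟩
  rcases le_total t 0 with ht | ht
  · rw [hγβ ht]
    exact hp t ht
  · exact hforward t γ (hγβ Set.self_mem_Iic) (fun s _ => hγ s) t ⟨ht, le_rfl⟩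

theorem exists_isPinchedTrajectory : ∃ H F, IsPinchedTrajectory H F := by
  set μ : ℝ := -Real.goldenConj
  have hμ : 0 < μ := neg_pos.2 Real.goldenConj_neg
  have hμsq : μ ^ 2 + μ = 1 := by linear_combination Real.goldenConj_sq
  have hv : saddleLinearization (-(1, 2 * (2 + μ))) = μ • -(1, 2 * (2 + μ)) := by
    rw [map_neg, saddleLinearization_eigenvector hμsq, smul_neg]
  have hresolvent : ∀ n : ℕ, (n + 2 : ℝ) * μ ∈ resolventSet ℝ saddleLinearization := fun n => by
    have hlt : μ < (n + 2) * μ := by nlinarith [n.cast_nonneg (α := ℝ)]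
    exact mem_resolventSet_saddleLinearization (by nlinarith)
  obtain ⟨u, hu, hlim⟩ := exists_unstable_trajectory hμ hv hresolvent
    ((ContinuousLinearMap.fst ℝ ℝ ℝ).smulRight solitonLinear)
  obtain ⟨r₀, hr₀⟩ := eventually_atBot.1
    (hu.and (eventually_isPinched_saddle_add hμ hv (by simp) hlim))
  refine exists_isPinchedTrajectory_of_hasDerivAt (β := fun t => (1 / 2, 0) + u (t + r₀))
    (fun t ht => ?_) fun t ht => ?_
  · refine (((hr₀ (t + r₀) (by linarith)).1.comp_add_const t r₀).const_add _).congr_deriv ?_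
    exact (solitonField_saddle_add _).symm
  · simpa using (hr₀ (t + r₀) (by linarith)).2

/-! ### Asymptotics -/

section MonotoneConvergence

theorem exists_tendsto_atTop_of_deriv_le {u w u' w' : ℝ → ℝ} {a C : ℝ}
    (hu : ∀ t ≥ a, HasDerivAt u (u' t) t) (hw : ∀ t ≥ a, HasDerivAt w (w' t) t)
    (hnonneg : ∀ t ≥ a, 0 ≤ u' t) (hle : ∀ t ≥ a, u' t ≤ w' t) (hC : ∀ t ≥ a, w t ≤ C) :
    ∃ l, Tendsto u atTop (𝓝 l) := by
  have hmono {f f' : ℝ → ℝ} (hf : ∀ t ≥ a, HasDerivAt f (f' t) t) (hf' : ∀ t ≥ a, 0 ≤ f' t) :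
      MonotoneOn f (Set.Ici a) :=
    monotoneOn_of_hasDerivWithinAt_nonneg (convex_Ici a) (HasDerivAt.continuousOn hf)
      (fun t ht => (hf t (interior_subset ht)).hasDerivWithinAt)
      fun t ht => hf' t (interior_subset ht)
  have hu_mono : Monotone fun t => u (max t a) := fun s t hst =>
    hmono hu hnonneg (le_max_right s a) (le_max_right t a) (max_le_max_right a hst)
  have hbdd : BddAbove (Set.range fun t => u (max t a)) := by
    refine ⟨C - (w a - u a), Set.forall_mem_range.2 fun t => ?_⟩
    have hdiff : w a - u a ≤ w (max t a) - u (max t a) :=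
      hmono (fun t ht => (hw t ht).fun_sub (hu t ht)) (fun t ht => sub_nonneg.2 (hle t ht))
        Set.self_mem_Ici (le_max_right t a) (le_max_right t a)
    linarith [hC (max t a) (le_max_right _ _)]
  exact ⟨_, (tendsto_atTop_ciSup hu_mono hbdd).congr'
    ((eventually_ge_atTop a).mono fun t ht => by rw [max_eq_left ht])⟩

theorem exists_tendsto_atBot_of_le_deriv {u w u' w' : ℝ → ℝ} {a C : ℝ}
    (hu : ∀ t ≤ a, HasDerivAt u (u' t) t) (hw : ∀ t ≤ a, HasDerivAt w (w' t) t)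
    (hnonpos : ∀ t ≤ a, u' t ≤ 0) (hle : ∀ t ≤ a, w' t ≤ u' t) (hC : ∀ t ≤ a, w t ≤ C) :
    ∃ l, Tendsto u atBot (𝓝 l) := by
  have hneg {f f' : ℝ → ℝ} (hf : ∀ t ≤ a, HasDerivAt f (f' t) t) :
      ∀ t ≥ -a, HasDerivAt (fun t => f (-t)) (-f' (-t)) t := fun t ht => by
    simpa using HasDerivAt.comp_const_sub 0 t (by simpa using hf (-t) (neg_le.1 ht))
  obtain ⟨l, hl⟩ := exists_tendsto_atTop_of_deriv_le (hneg hu) (hneg hw)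
    (fun t ht => neg_nonneg.2 (hnonpos _ (neg_le.1 ht)))
    (fun t ht => neg_le_neg (hle _ (neg_le.1 ht))) fun t ht => hC _ (neg_le.1 ht)
  exact ⟨l, by simpa [Function.comp_def] using hl.comp tendsto_neg_atBot_atTop⟩

end MonotoneConvergence

theorem tendsto_div_sq_of_tendsto_deriv {u u' : ℝ → ℝ} {l : ℝ} (hu : ∀ t, HasDerivAt u (u' t) t)
    (hl : Tendsto u' atTop (𝓝 l)) : Tendsto (fun t => u t / t ^ 2) atTop (𝓝 0) := by
  obtain ⟨a, ha⟩ := eventually_atTop.1 (hl.norm.eventually_le_const (lt_add_one ‖l‖))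
  have hlip : (fun t => u t - u a) =O[atTop] fun t => t - a := by
    refine .of_bound (‖l‖ + 1) ((eventually_ge_atTop a).mono fun t ht => ?_)
    exact (convex_Ici a).norm_image_sub_le_of_norm_hasDerivWithin_le
      (fun s _ => (hu s).hasDerivWithinAt) ha Set.self_mem_Ici ht
  have hconst (c : ℝ) : (fun _ => c) =O[atTop] (id : ℝ → ℝ) :=
    (Asymptotics.isLittleO_const_id_atTop c).isBigO
  have hlin : u =O[atTop] (id : ℝ → ℝ) := by
    simpa using (hlip.trans ((Asymptotics.isBigO_refl id atTop).sub (hconst a))).add (hconst (u a))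
  have hsq : (id : ℝ → ℝ) =o[atTop] fun t => t ^ 2 := by
    simpa [Function.id_def] using Asymptotics.isLittleO_pow_pow_atTop_of_lt (𝕜 := ℝ) one_lt_two
  exact (hlin.trans_isLittleO hsq).tendsto_div_nhds_zero

theorem tendsto_div_one_of_tendsto_sub {α : Type*} {l : Filter α} {u v : α → ℝ} {c : ℝ}
    (hsub : Tendsto (fun t => u t - v t) l (𝓝 c)) (hv : Tendsto v l (Bornology.cobounded ℝ)) :
    Tendsto (fun t => u t / v t) l (𝓝 1) := by
  have hquot := (hsub.mul (tendsto_inv₀_cobounded.comp hv)).add_const 1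
  rw [mul_zero, zero_add] at hquot
  refine hquot.congr' ?_
  filter_upwards [hv (Bornology.eventually_ne_cobounded 0)] with t ht
  rw [Function.comp_apply, ← div_eq_mul_inv, sub_div, div_self ht, sub_add_cancel]

namespace IsPinched

variable {H F : ℝ} (hp : IsPinched H F)

include hp

theorem half_snd_le : F / 2 ≤ H - 1 / 2 := by
  nlinarith [hp.deriv_neg, hp.pos, hp.lt_half, hp.snd_neg]

theorem fst_mul_neg_snd_lt : H * -F < 1 / 2 := by
  nlinarith [hp.deriv_add_sq_pos, sq_nonneg H]

theorem fst_sq_le : H ^ 2 ≤ (F ^ 2)⁻¹ / 4 := by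
  have hF := hp.snd_neg.ne
  have hpos : 0 < H * -F := mul_pos hp.pos (neg_pos.2 hp.snd_neg)
  rw [← one_div, div_div, le_div_iff₀ (by positivity)]
  nlinarith [hp.fst_mul_neg_snd_lt]

end IsPinched

namespace IsPinchedTrajectory

variable {H F : ℝ → ℝ} (hT : IsPinchedTrajectory H F)

include hT

theorem hasDerivAt_fst (t : ℝ) : HasDerivAt H (H t * F t - 2 * H t ^ 2 + 1 / 2) t :=
  (hasDerivAt_prodMk_iff.1 (hT.hasDerivAt t)).1

theorem hasDerivAt_snd (t : ℝ) : HasDerivAt F (2 * H t * F t - 2 * H t ^ 2 + 1 / 2) t :=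
  (hasDerivAt_prodMk_iff.1 (hT.hasDerivAt t)).2

theorem antitone_fst : Antitone H :=
  antitone_of_hasDerivAt_nonpos hT.hasDerivAt_fst fun t => (hT.isPinched t).deriv_neg.le

theorem snd_neg (t : ℝ) : F t < 0 := (hT.isPinched t).snd_neg

theorem mul_exp_le_snd {t : ℝ} (ht : t ≤ 0) : F 0 * Real.exp (H 0 * t) ≤ F t := by
  have hderiv (s : ℝ) : HasDerivAt (fun s => F s * Real.exp (-(H 0 * s)))
      ((2 * H s * F s - 2 * H s ^ 2 + 1 / 2 - H 0 * F s) * Real.exp (-(H 0 * s))) s :=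
    ((hT.hasDerivAt_snd s).mul ((hasDerivAt_id s).const_mul (H 0)).fun_neg.exp).congr_deriv (by
      simp only [id, mul_one]; ring)
  have hanti : AntitoneOn (fun s => F s * Real.exp (-(H 0 * s))) (Set.Iic 0) := by
    refine antitoneOn_of_hasDerivWithinAt_nonpos (convex_Iic 0)
      (HasDerivAt.continuousOn fun s _ => hderiv s) (fun s _ => (hderiv s).hasDerivWithinAt)
      fun s hs => mul_nonpos_of_nonpos_of_nonneg ?_ (Real.exp_pos _).le
    have hHs : H 0 ≤ H s := hT.antitone_fst (interior_subset (s := Set.Iic (0 : ℝ)) hs)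
    nlinarith [(hT.isPinched s).deriv_neg, hT.snd_neg s]
  have hle := hanti ht Set.self_mem_Iic ht
  simpa [Real.exp_neg, ← div_eq_mul_inv, le_div_iff₀ (Real.exp_pos _)] using hle

theorem tendsto_snd_atBot : Tendsto F atBot (𝓝 0) := by
  have hexp : Tendsto (fun t => F 0 * Real.exp (H 0 * t)) atBot (𝓝 0) := by
    simpa using (tendsto_exp_mul_atBot (hT.isPinched 0).pos).const_mul (F 0)
  exact tendsto_of_tendsto_of_tendsto_of_le_of_le' hexp tendsto_const_nhds
    ((eventually_le_atBot 0).mono fun t ht => hT.mul_exp_le_snd ht)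
    (.of_forall fun t => (hT.snd_neg t).le)

theorem tendsto_fst_atBot : Tendsto H atBot (𝓝 (1 / 2)) := by
  have hlower : Tendsto (fun t => 1 / 2 + F t / 2) atBot (𝓝 (1 / 2)) := by
    simpa only [zero_div, add_zero] using (hT.tendsto_snd_atBot.div_const 2).const_add (1 / 2)
  exact tendsto_of_tendsto_of_tendsto_of_le_of_le hlower tendsto_const_nhds
    (fun t => by linarith [(hT.isPinched t).half_snd_le]) fun t => (hT.isPinched t).lt_half.le

theorem tendsto_deriv_fst_atBot : Tendsto (deriv H) atBot (𝓝 0) := by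
  rw [funext fun t => (hT.hasDerivAt_fst t).deriv]
  have hlim := ((hT.tendsto_fst_atBot.mul hT.tendsto_snd_atBot).sub
    ((hT.tendsto_fst_atBot.pow 2).const_mul 2)).add_const (1 / 2)
  convert hlim using 2
  norm_num

theorem tendsto_deriv_snd_atBot : Tendsto (deriv F) atBot (𝓝 0) := by
  rw [funext fun t => (hT.hasDerivAt_snd t).deriv]
  have hlim := (((hT.tendsto_fst_atBot.const_mul 2).mul hT.tendsto_snd_atBot).sub
    ((hT.tendsto_fst_atBot.pow 2).const_mul 2)).add_const (1 / 2)
  convert hlim using 2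
  norm_num

theorem exists_tendsto_atBot_of_snd_le {u u' : ℝ → ℝ} (hu : ∀ t, HasDerivAt u (u' t) t)
    (hnonpos : ∀ t, u' t ≤ 0) (hle : ∀ t, F t ≤ u' t) : ∃ l, Tendsto u atBot (𝓝 l) := by
  have hpos := (hT.isPinched 0).pos
  refine exists_tendsto_atBot_of_le_deriv (a := 0) (w := fun t => F t / H 0) (C := 0)
    (fun t _ => hu t) (fun t _ => (hT.hasDerivAt_snd t).div_const _) (fun t _ => hnonpos t)
    (fun t ht => ((div_le_iff₀ hpos).2 ?_).trans (hle t))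
    fun t _ => (div_neg_of_neg_of_pos (hT.snd_neg t) hpos).le
  have hHt : H 0 ≤ H t := hT.antitone_fst ht
  nlinarith [(hT.isPinched t).deriv_neg, hT.snd_neg t]

theorem exists_pos_forall_deriv_snd_le :
    ∃ c > 0, ∀ t ≥ 0, 2 * H t * F t - 2 * H t ^ 2 + 1 / 2 ≤ -c := by
  refine ⟨1 / 2 - 2 * H 0 ^ 2, by linarith [(hT.isPinched 0).sq_lt], fun t ht => ?_⟩
  have hsq : H t ^ 2 ≤ H 0 ^ 2 := pow_le_pow_left₀ (hT.isPinched t).pos.le (hT.antitone_fst ht) 2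
  linarith [(hT.isPinched t).deriv_neg]

theorem tendsto_snd_atTop : Tendsto F atTop atBot := by
  obtain ⟨c, hc, hle⟩ := hT.exists_pos_forall_deriv_snd_le
  have hline : Tendsto (fun t => F 0 - c * t) atTop atBot :=
    tendsto_const_nhds.add_atBot (tendsto_neg_atTop_atBot.comp (tendsto_id.const_mul_atTop hc))
  refine tendsto_atBot_mono' _ ((eventually_ge_atTop 0).mono fun t ht => ?_) hline
  have hmean := (convex_Ici (0 : ℝ)).image_sub_le_mul_sub_of_deriv_le
    (HasDerivAt.continuousOn fun s _ => hT.hasDerivAt_snd s)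
    (fun s _ => (hT.hasDerivAt_snd s).differentiableAt.differentiableWithinAt)
    (fun s hs => (hT.hasDerivAt_snd s).deriv.trans_le (hle s (interior_subset hs)))
    0 Set.self_mem_Ici t ht ht
  linarith

theorem tendsto_fst_atTop : Tendsto H atTop (𝓝 0) := by
  have hupper : Tendsto (fun t => 1 / 2 / -F t) atTop (𝓝 0) :=
    tendsto_const_nhds.div_atTop (tendsto_neg_atBot_atTop.comp hT.tendsto_snd_atTop)
  exact tendsto_of_tendsto_of_tendsto_of_le_of_le tendsto_const_nhds hupper
    (fun t => (hT.isPinched t).pos.le) fun t =>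
      (le_div_iff₀ (neg_pos.2 (hT.snd_neg t))).2 (hT.isPinched t).fst_mul_neg_snd_lt.le

theorem tendsto_fst_mul_snd_atTop : Tendsto (fun t => H t * F t) atTop (𝓝 (-(1 / 2))) := by
  have hsq (c : ℝ) : Tendsto (fun t => c * H t ^ 2 - 1 / 2) atTop (𝓝 (-(1 / 2))) := by
    simpa using ((hT.tendsto_fst_atTop.pow 2).const_mul c).sub_const (1 / 2)
  exact tendsto_of_tendsto_of_tendsto_of_le_of_le (hsq 1) (hsq 2)
    (fun t => by linarith [(hT.isPinched t).deriv_add_sq_pos])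
    fun t => by linarith [(hT.isPinched t).deriv_neg]

theorem tendsto_deriv_fst_atTop : Tendsto (deriv H) atTop (𝓝 0) := by
  rw [funext fun t => (hT.hasDerivAt_fst t).deriv]
  have hlim := (hT.tendsto_fst_mul_snd_atTop.sub
    ((hT.tendsto_fst_atTop.pow 2).const_mul 2)).add_const (1 / 2)
  convert hlim using 2
  norm_num

theorem tendsto_deriv_snd_atTop : Tendsto (deriv F) atTop (𝓝 (-1 / 2)) := by
  rw [funext fun t => (hT.hasDerivAt_snd t).deriv]
  simp only [mul_assoc]
  have hlim := ((hT.tendsto_fst_mul_snd_atTop.const_mul 2).sub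
    ((hT.tendsto_fst_atTop.pow 2).const_mul 2)).add_const (1 / 2)
  convert hlim using 2
  norm_num

theorem exists_tendsto_atTop_of_le_snd_sq_inv {u u' : ℝ → ℝ} (hu : ∀ t, HasDerivAt u (u' t) t)
    (hnonneg : ∀ t, 0 ≤ u' t) (hle : ∀ t, u' t ≤ (F t ^ 2)⁻¹) : ∃ l, Tendsto u atTop (𝓝 l) := by
  obtain ⟨c, hc, hF'⟩ := hT.exists_pos_forall_deriv_snd_le
  refine exists_tendsto_atTop_of_deriv_le (a := 0) (w := fun t => (F t)⁻¹ / c) (C := 0)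
    (fun t _ => hu t)
    (fun t _ => ((hT.hasDerivAt_snd t).fun_inv (hT.snd_neg t).ne).div_const c)
    (fun t _ => hnonneg t) (fun t ht => (hle t).trans ?_)
    fun t _ => div_nonpos_of_nonpos_of_nonneg (inv_nonpos.2 (hT.snd_neg t).le) hc.le
  rw [le_div_iff₀ hc, inv_mul_eq_div]
  exact div_le_div_of_nonneg_right (le_neg.1 (hF' t ht)) (sq_nonneg _)

theorem exists_tendsto_snd_add_atTop : ∃ l, Tendsto (fun t => F t + t / 2) atTop (𝓝 l) := by
  refine hT.exists_tendsto_atTop_of_le_snd_sq_inv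
    (fun t => (hT.hasDerivAt_snd t).fun_add ((hasDerivAt_id t).div_const 2)) (fun t => ?_)
    fun t => ?_
  · linarith [(hT.isPinched t).deriv_add_sq_pos]
  · have hinv : 0 ≤ (F t ^ 2)⁻¹ := by positivity
    linarith [(hT.isPinched t).deriv_neg, (hT.isPinched t).fst_sq_le]

theorem tendsto_snd_div_atTop : Tendsto (fun t => F t / (-t / 2)) atTop (𝓝 1) := by
  obtain ⟨l, hl⟩ := hT.exists_tendsto_snd_add_atTop
  exact tendsto_div_one_of_tendsto_sub (hl.congr fun t => by ring)
    ((tendsto_neg_atTop_atBot.atBot_div_const two_pos).mono_right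
      IsOrderBornology.atBot_le_cobounded)

theorem tendsto_mul_fst_atTop : Tendsto (fun t => t * H t) atTop (𝓝 1) := by
  have hlim := (hT.tendsto_fst_mul_snd_atTop.const_mul (-2)).mul
    (hT.tendsto_snd_div_atTop.inv₀ one_ne_zero)
  convert hlim using 2 with t
  · have := (hT.snd_neg t).ne
    field_simp
  · norm_num

end IsPinchedTrajectory

theorem contDiff_of_hasDerivAt_comp {E : Type*} [NormedAddCommGroup E] [NormedSpace ℝ E]
    {V : E → E} (hV : ContDiff ℝ ∞ V) {γ : ℝ → E} (hγ : ∀ t, HasDerivAt γ (V (γ t)) t) :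
    ContDiff ℝ ∞ γ := by
  refine contDiff_infty.2 fun n => ?_
  induction n with
  | zero => exact contDiff_zero.2 (continuous_iff_continuousAt.2 fun t => (hγ t).continuousAt)
  | succ n ih =>
    refine contDiff_succ_iff_deriv.2 ⟨fun t => (hγ t).differentiableAt,
      fun hω => absurd hω (WithTop.coe_ne_top (a := (n : ℕ∞))), ?_⟩
    rw [funext fun t => (hγ t).deriv]
    exact (contDiff_infty.1 hV n).comp ih

theorem exists_contDiff_deriv_eq {E : Type*} [NormedAddCommGroup E] [NormedSpace ℝ E]
    [CompleteSpace E] {u : ℝ → E} (hu : ContDiff ℝ ∞ u) :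
    ∃ U : ℝ → E, ContDiff ℝ ∞ U ∧ deriv U = u := by
  have hderiv : ∀ r, HasDerivAt (fun r => ∫ t in (0 : ℝ)..r, u t) (u r) r := fun r =>
    (hu.continuous.integral_hasStrictDerivAt 0 r).hasDerivAt
  have heq : deriv (fun r => ∫ t in (0 : ℝ)..r, u t) = u := funext fun r => (hderiv r).deriv
  exact ⟨_, contDiff_infty_iff_deriv.2 ⟨fun r => (hderiv r).differentiableAt, by rwa [heq]⟩, heq⟩

theorem exists_contDiff_isPinchedTrajectory_deriv : ∃ h φ : ℝ → ℝ,
    ContDiff ℝ ∞ h ∧ ContDiff ℝ ∞ φ ∧ IsPinchedTrajectory (deriv h) (deriv φ) := by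
  obtain ⟨H, F, hT⟩ := exists_isPinchedTrajectory
  have hsmooth := contDiff_of_hasDerivAt_comp contDiff_solitonField hT.hasDerivAt
  obtain ⟨h, hh, rfl : deriv h = H⟩ := exists_contDiff_deriv_eq hsmooth.fst
  obtain ⟨φ, hφ, rfl : deriv φ = F⟩ := exists_contDiff_deriv_eq hsmooth.snd
  exact ⟨h, φ, hh, hφ, hT⟩

namespace IsPinchedTrajectory

variable {H F h φ : ℝ → ℝ}

theorem isSeparatrixFrom (hT : IsPinchedTrajectory H F) :
    IsSeparatrixFrom solitonField (1 / 2, 0) fun r => (H r, F r) :=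
  ⟨isSaddlePoint_solitonField, hT.hasDerivAt,
    ⟨0, fun heq => (hT.isPinched 0).lt_half.ne (congrArg Prod.fst heq)⟩,
    hT.tendsto_fst_atBot.prodMk_nhds hT.tendsto_snd_atBot⟩

theorem exists_tendsto_potential_atBot (hT : IsPinchedTrajectory H (deriv φ))
    (hφ : Differentiable ℝ φ) : ∃ c, Tendsto φ atBot (𝓝 c) :=
  hT.exists_tendsto_atBot_of_snd_le (fun r => (hφ r).hasDerivAt) (fun r => (hT.snd_neg r).le)
    fun _ => le_rfl

theorem exists_tendsto_profile_sub_atBot (hT : IsPinchedTrajectory (deriv h) F)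
    (hh : Differentiable ℝ h) : ∃ c, Tendsto (fun r => h r - r / 2) atBot (𝓝 c) :=
  hT.exists_tendsto_atBot_of_snd_le
    (fun r => (hh r).hasDerivAt.fun_sub ((hasDerivAt_id r).div_const 2))
    (fun r => by linarith [(hT.isPinched r).lt_half])
    fun r => by linarith [(hT.isPinched r).half_snd_le, hT.snd_neg r]

theorem tendsto_profile_div_atBot (hT : IsPinchedTrajectory (deriv h) F)
    (hh : Differentiable ℝ h) : Tendsto (fun r => h r / (r / 2)) atBot (𝓝 1) := by
  obtain ⟨c, hc⟩ := hT.exists_tendsto_profile_sub_atBot hh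
  exact tendsto_div_one_of_tendsto_sub hc
    ((tendsto_id.atBot_div_const two_pos).mono_right IsOrderBornology.atBot_le_cobounded)

theorem tendsto_log_neg_snd_sub_log_atTop (hT : IsPinchedTrajectory H F) :
    Tendsto (fun r => Real.log (-F r) - Real.log r) atTop (𝓝 (Real.log (1 / 2))) := by
  have hlim : Tendsto (fun r => F r / (-r / 2) * (1 / 2)) atTop (𝓝 (1 / 2)) := by
    simpa only [one_mul] using hT.tendsto_snd_div_atTop.mul_const (1 / 2)
  refine (hlim.log (by norm_num)).congr' ((eventually_gt_atTop 0).mono fun r hr => ?_)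
  dsimp only
  rw [← Real.log_div (neg_pos.2 (hT.snd_neg r)).ne' hr.ne']
  congr 1
  field_simp

theorem exists_tendsto_log_neg_snd_sub_profile_atTop (hT : IsPinchedTrajectory (deriv h) F)
    (hh : Differentiable ℝ h) :
    ∃ c, Tendsto (fun r => Real.log (-F r) - h r) atTop (𝓝 c) := by
  set H := deriv h
  have hderiv (r : ℝ) : HasDerivAt (fun r => Real.log (-F r) - h r)
      ((H r * F r - 2 * H r ^ 2 + 1 / 2) / F r) r := by
    have hF := (hT.snd_neg r).ne
    refine (((hT.hasDerivAt_snd r).fun_neg.log (neg_ne_zero.2 hF)).fun_sub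
      (hh r).hasDerivAt).congr_deriv ?_
    rw [neg_div_neg_eq, div_sub' hF]
    ring
  refine hT.exists_tendsto_atTop_of_le_snd_sq_inv hderiv
    (fun r => div_nonneg_of_nonpos (hT.isPinched r).deriv_neg.le (hT.snd_neg r).le) fun r => ?_
  have hp := hT.isPinched r
  have hF := hT.snd_neg r
  have hinv : (F r)⁻¹ ≤ -H r ^ 2 := by
    rw [← one_div, div_le_iff_of_neg hF]
    nlinarith [hp.fst_mul_neg_snd_lt, hp.pos, hp.lt_half]
  rw [div_le_iff_of_neg hF, pow_two, mul_inv, inv_mul_cancel_right₀ hF.ne]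
  linarith [hp.deriv_add_sq_pos]

theorem exists_tendsto_profile_sub_log_atTop (hT : IsPinchedTrajectory (deriv h) F)
    (hh : Differentiable ℝ h) : ∃ c, Tendsto (fun r => h r - Real.log r) atTop (𝓝 c) := by
  obtain ⟨c, hc⟩ := hT.exists_tendsto_log_neg_snd_sub_profile_atTop hh
  exact ⟨_, (hT.tendsto_log_neg_snd_sub_log_atTop.sub hc).congr fun r => by ring⟩

theorem tendsto_profile_div_log_atTop (hT : IsPinchedTrajectory (deriv h) F)
    (hh : Differentiable ℝ h) : Tendsto (fun r => h r / Real.log r) atTop (𝓝 1) := by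
  obtain ⟨c, hc⟩ := hT.exists_tendsto_profile_sub_log_atTop hh
  exact tendsto_div_one_of_tendsto_sub hc
    (Real.tendsto_log_atTop.mono_right IsOrderBornology.atTop_le_cobounded)

theorem tendsto_potential_div_atTop (hT : IsPinchedTrajectory H (deriv φ))
    (hφ : Differentiable ℝ φ) : Tendsto (fun r => φ r / (-(r ^ 2) / 4)) atTop (𝓝 1) := by
  obtain ⟨l, hl⟩ := hT.exists_tendsto_snd_add_atTop
  have hderiv (r : ℝ) : HasDerivAt (fun r => φ r + r ^ 2 / 4) (deriv φ r + r / 2) r :=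
    ((hφ r).hasDerivAt.fun_add ((hasDerivAt_pow 2 r).div_const 4)).congr_deriv (by ring)
  have hlim := ((tendsto_div_sq_of_tendsto_deriv hderiv hl).const_mul (-4)).add_const 1
  rw [mul_zero, zero_add] at hlim
  refine hlim.congr' ((eventually_ne_atTop 0).mono fun r hr => ?_)
  field_simp
  ring

section Geometry

variable {g : LineTorusMetric}

theorem sectionalCurvatureMem (hT : IsPinchedTrajectory (deriv h) F) (hh : ContDiff ℝ ∞ h)
    (hg : IsWarpedMetric g h) (p : LineTorus) :
    SectionalCurvatureMem g p (Set.Ioo (-1 / 4) 0) := by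
  have hp := hT.isPinched p.1
  refine sectionalCurvatureMem_of_isWarpedMetric (contDiff_infty.1 hh 2) hg (convex_Ioo _ _) p
    ?_ ⟨by linarith [hp.sq_lt], neg_neg_of_pos (pow_pos hp.pos 2)⟩
  rw [(hT.hasDerivAt_fst p.1).deriv]
  constructor <;> linarith [hp.deriv_neg, hp.sq_lt, hp.deriv_add_sq_pos]

theorem sectionalCurvatureTendsto_atBot (hT : IsPinchedTrajectory (deriv h) F)
    (hh : ContDiff ℝ ∞ h) (hg : IsWarpedMetric g h) :
    SectionalCurvatureTendsto g atBot (-1 / 4) := by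
  convert sectionalCurvatureTendsto_of_tendsto_deriv (contDiff_infty.1 hh 2) hg
    hT.tendsto_fst_atBot hT.tendsto_deriv_fst_atBot using 1
  norm_num

theorem sectionalCurvatureTendsto_atTop (hT : IsPinchedTrajectory (deriv h) F)
    (hh : ContDiff ℝ ∞ h) (hg : IsWarpedMetric g h) : SectionalCurvatureTendsto g atTop 0 := by
  simpa using sectionalCurvatureTendsto_of_tendsto_deriv (contDiff_infty.1 hh 2) hg
    hT.tendsto_fst_atTop hT.tendsto_deriv_fst_atTop

theorem isGradientRicciSoliton (hT : IsPinchedTrajectory (deriv h) (deriv φ))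
    (hh : ContDiff ℝ ∞ h) (hφ : ContDiff ℝ ∞ φ) (hg : IsWarpedMetric g h) :
    IsGradientRicciSoliton g (fun p => φ p.1) 1 :=
  isGradientRicciSoliton_of_isWarpedMetric (contDiff_infty.1 hh 2) hg hφ
    (fun r => (hT.hasDerivAt_fst r).deriv) fun r => (hT.hasDerivAt_snd r).deriv

end Geometry

end IsPinchedTrajectory

end Soliton

end

theorem mainTheorem5 :
    ∃ (h φ : ℝ → ℝ) (g : Soliton.LineTorusMetric) (f : Soliton.LineTorus → ℝ),
      -- an expanding gradient Ricci soliton of warped form, with a radial potential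
      ContDiff ℝ ∞ h ∧ ContDiff ℝ ∞ φ ∧
      Soliton.IsWarpedMetric g h ∧
      (∀ p : Soliton.LineTorus, f p = φ p.1) ∧
      Soliton.IsGradientRicciSoliton g f 1 ∧
      -- pinched sectional curvature
      (∀ p : Soliton.LineTorus, Soliton.SectionalCurvatureMem g p (Set.Ioo (-1 / 4) 0)) ∧
      -- the end `r → -∞`: the hyperbolic cusp soliton `dr² + e^{r + 2c} (dx² + dy²)`
      (Tendsto (fun r => h r / (r / 2)) atBot (𝓝 1) ∧
        (∃ c : ℝ, Tendsto (fun r => h r - r / 2) atBot (𝓝 c)) ∧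
        Tendsto (deriv h) atBot (𝓝 (1 / 2)) ∧
        Tendsto (deriv (deriv h)) atBot (𝓝 0) ∧
        (∃ c : ℝ, Tendsto φ atBot (𝓝 c)) ∧
        Tendsto (deriv φ) atBot (𝓝 0) ∧
        Tendsto (deriv (deriv φ)) atBot (𝓝 0) ∧
        Soliton.SectionalCurvatureTendsto g atBot (-1 / 4)) ∧
      -- the end `r → +∞`: the cone `dr² + e^{2c} r² (dx² + dy²)`, locally the Gaussian soliton
      (Tendsto (fun r => h r / Real.log r) atTop (𝓝 1) ∧
        (∃ c : ℝ, Tendsto (fun r => h r - Real.log r) atTop (𝓝 c)) ∧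
        Tendsto (fun r => r * deriv h r) atTop (𝓝 1) ∧
        Tendsto (deriv (deriv h)) atTop (𝓝 0) ∧
        Tendsto (fun r => φ r / (-(r ^ 2) / 4)) atTop (𝓝 1) ∧
        Tendsto (fun r => deriv φ r / (-r / 2)) atTop (𝓝 1) ∧
        Tendsto (deriv (deriv φ)) atTop (𝓝 (-1 / 2)) ∧
        Soliton.SectionalCurvatureTendsto g atTop 0) ∧
      -- `(h', f')` is a separatrix of the planar system, with vertical asymptote `H = 0`
      Soliton.IsSeparatrixFrom Soliton.solitonField (1 / 2, 0)
        (fun r => (deriv h r, deriv φ r)) ∧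
      Tendsto (deriv h) atTop (𝓝 0) ∧
      Tendsto (deriv φ) atTop atBot := by
  obtain ⟨h, φ, hh, hφ, hT⟩ := Soliton.exists_contDiff_isPinchedTrajectory_deriv
  have hh' : Differentiable ℝ h := hh.differentiable (by simp)
  have hφ' : Differentiable ℝ φ := hφ.differentiable (by simp)
  have hg := Soliton.isWarpedMetric_warpedMetric h hh
  exact ⟨h, φ, Soliton.warpedMetric h hh, fun p => φ p.1, hh, hφ, hg, fun _ => rfl,
    hT.isGradientRicciSoliton hh hφ hg, hT.sectionalCurvatureMem hh hg,
    ⟨hT.tendsto_profile_div_atBot hh', hT.exists_tendsto_profile_sub_atBot hh',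
      hT.tendsto_fst_atBot, hT.tendsto_deriv_fst_atBot, hT.exists_tendsto_potential_atBot hφ',
      hT.tendsto_snd_atBot, hT.tendsto_deriv_snd_atBot, hT.sectionalCurvatureTendsto_atBot hh hg⟩,
    ⟨hT.tendsto_profile_div_log_atTop hh', hT.exists_tendsto_profile_sub_log_atTop hh',
      hT.tendsto_mul_fst_atTop, hT.tendsto_deriv_fst_atTop, hT.tendsto_potential_div_atTop hφ',
      hT.tendsto_snd_div_atTop, hT.tendsto_deriv_snd_atTop,
      hT.sectionalCurvatureTendsto_atTop hh hg⟩,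
    hT.isSeparatrixFrom, hT.tendsto_fst_atTop, hT.tendsto_snd_atTop⟩
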